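/- **Setting.** Let $d_x\ge 0$, $d_y\ge 1$, let $f,g:\mathbb R^{d_x}\times\mathbb R^{d_y}\to\mathbb R$ be twice continuously differentiable, and let $g(x,\cdot)$ be $\mu$-strongly convex for every $x$, $\mu>0$. Assume that $f$ is $L_{f,0}$-Lipschitz, that $\nabla f$ and $\nabla g$ are $L_{f,1}$- and $L_{g,1}$-Lipschitz, that $\nabla_x\nabla_y g$ and $\nabla_y\nabla_y g$ are $L_{g,2}$-Lipschitz (all jointly in $(x,y)$, operator norms for matrices), and that $\|\nabla_x f\|\le C_{f_x}$, $\|\nabla_y f\|\le C_{f_y}$, $\|\nabla_x\nabla_y g\|\le C_{g_{xy}}$, $\|\nabla_y\nabla_y g\|\le C_{g_{yy}}$ everywhere. Put $y^*(x)=\arg\min_y g(x,y)$, $\Phi(x)=f(x,y^*(x))$, $R(x,y,v)=\frac12v^T\nabla_y\nabla_yg(x,y)v-v^T\nabla_yf(x,y)$ and $\bar\nabla f(x,y,v)=\nabla_xf(x,y)-\nabla_x\nabla_yg(x,y)v$. **S-TFBO.** Given $x_0,y_0,v_0$, $\alpha_0\ge1$, $\beta_0,\gamma_0>0$, and with $\varphi_t=\max\{\beta_t,\gamma_t\}$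 for $t\ge0$, iterate with positive $\alpha_t,\beta_t,\gamma_t$: $$\beta_{t+1}^2=\beta_t^2+\|\nabla_yg(x_t,y_t)\|^2,\quad \gamma_{t+1}^2=\gamma_t^2+\|\nabla_vR(x_t,y_t,v_t)\|^2,\quad \alpha_{t+1}^2=\alpha_t^2+\|\bar\nabla f(x_t,y_t,v_t)\|^2,$$ $$y_{t+1}=y_t-\tfrac1{\beta_{t+1}}\nabla_yg(x_t,y_t),\quad v_{t+1}=v_t-\tfrac1{\varphi_{t+1}}\nabla_vR(x_t,y_t,v_t),\quad x_{t+1}=x_t-\tfrac1{\alpha_{t+1}\varphi_{t+1}}\bar\nabla f(x_t,y_t,v_t).$$ **Constants.** Write $L=L_{g,1}$, $K=C_{g_{yy}}$, $G_0=\|\nabla_yg(x_0,y_0)\|$, $R_0=\|\nabla_vR(x_0,y_0,v_0)\|$ and $$M=\tfrac{L_{g,2}C_{f_y}}\mu+L_{f,1},\quad L_y=\tfrac{C_{g_{xy}}}\mu,\quad L_v=\Big(\tfrac{L_{f,1}}\mu+\tfrac{C_{f_y}L_{g,2}}{\mu^2}\Big)(1+L_y),\quad L_\Phi=M\Big(1+\tfrac{C_{g_{xy}}}\mu\Big)^2,$$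 $$\bar L=\max\Big\{2\Big(\tfrac{C_{f_y}^2L_{g,2}^2}{\mu^2}+L_{f,1}^2\Big)^{1/2},\sqrt2\,C_{g_{xy}}\Big\},\quad \kappa=\Big(\tfrac{4(\mu+K)^2}{\mu K}+8\Big)\tfrac{M^2}{\mu^2},$$ $$\lambda=\tfrac{4(\mu+K)(\mu+L)L_y^2}{\mu^3L\varphi_0}M^2,\quad a_0=(\kappa+1)\tfrac{(\mu+L)^2L_y^2}{\mu LC_\beta}+\lambda+\tfrac{4(\mu+K)^2L_v^2}{\mu K\gamma_0},$$ where $C_\beta$ is the unique real number satisfying, together with this $a_0$, $$C_\beta=\max\big\{\mu+L,\tfrac{2\mu L}{\mu+L},\beta_0,64a_0^2,1\big\}.$$ Further $$C_\gamma=\max\big\{2(\mu+K),\tfrac{\mu K}{\mu+K},\gamma_0,64a_0^2,1,K\big\},\quad C_\alpha=\max\big\{\tfrac{2L_\Phi}{\varphi_0},\alpha_0\big\},\quad \bar a=\tfrac{\sqrt2}\mu,\quad \bar b=\tfrac{\sqrt2C_{f_y}}\mu,$$ $$D_y=\tfrac{G_0^2}{\mu^2}+\Big(\tfrac{C_\beta}\mu+\tfrac{L_y}{\varphi_0}\Big)^2,\quad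 D_v=\tfrac{R_0^2}{\mu^2}+\Big(1+\tfrac{C_\gamma}\mu+\tfrac{L_v}{\varphi_0}\Big)^2,\quad E=4(\mu+K)\Big(\tfrac{M^2}{\mu^2}D_y+D_v\Big),$$ $$b_0=C_\beta+C_\gamma+E+\kappa\Big(\tfrac{C_\beta^2}{\beta_0}-\beta_0\Big)+(\kappa+1)(\mu+L)D_y,$$ $$a_1=6a_0,\quad b_1=4a_0\log\big(C_{g_{xy}}\bar a+C_{g_{xy}}\bar b+C_{f_x}+\alpha_0\big)+4a_0+2b_0,$$ $$c_2=2\log\big(C_{g_{xy}}\bar aa_1+C_{g_{xy}}\bar ab_1+C_{g_{xy}}\bar b+C_{f_x}+\alpha_0\big)+1,\qquad c_1=2\log(C_\alpha/\alpha_0),$$ $$A_y=\tfrac{(\mu+L)^2L_y^2}{\mu LC_\beta},\quad A_v=\lambda+\tfrac{4(\mu+K)^2L_v^2}{\mu KC_\gamma},\quad a_2=5A_y,\quad a_3=5A_v+\kappa a_2,$$ $$b_2(c)=A_yc+\tfrac{C_\beta^2}{\beta_0}-\beta_0+(\mu+L)D_y,\quad b_3(c)=\tfrac{C_\gamma^2}{\gamma_0}-\gamma_0+E+A_vc+\kappa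 b_2(c),\quad b_2=b_2(c_2),\quad b_3=b_3(c_2),$$ $$a_4=\tfrac{2\bar L^2a_2}{\mu^2C_\alpha}\Big(1+\tfrac{2M^2}{\mu^2}\Big)+\tfrac{4\bar L^2a_3}{\mu^2C_\alpha},$$ $$b_4=\tfrac{2\bar L^2}{\mu^2}\Big(1+\tfrac{2M^2}{\mu^2}\Big)\Big(\tfrac{b_2}{C_\alpha}+\tfrac{b_2(c_1)}{\alpha_0}\Big)+\tfrac{4\bar L^2}{\mu^2}\Big(\tfrac{b_3}{C_\alpha}+\tfrac{b_3(c_1)}{\alpha_0}\Big)+\tfrac{2L_\Phi}{\varphi_0^2}\tfrac{C_\alpha^2}{\alpha_0^2}.$$ **Statement.** For all integers $0\le k_0<t$, $$\sum_{k=k_0}^t\frac{\|\nabla_yg(x_k,y_k)\|^2}{\beta_{k+1}}\le a_2\log(t+1)+b_2,\qquad \sum_{k=k_0}^t\frac{\|\nabla_vR(x_k,y_k,v_k)\|^2}{\varphi_{k+1}}\le a_3\log(t+1)+b_3,$$ and $\varphi_t\le a_1\log t+b_1$ for all $t\ge1$. If moreover $\Phi$ is bounded below, then for all $t\ge1$ $$\alpha_t\le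 C_\alpha+\Big(a_4\log t+b_4+4\big(\Phi(x_0)-\inf_x\Phi(x)\big)\Big)\varphi_t .$$ -/

import Mathlib

open scoped Gradient

namespace STFBO

/-- The Euclidean space of dimension `d`. -/
abbrev Vec (d : ℕ) : Type := EuclideanSpace ℝ (Fin d)

noncomputable section

section Derivatives

variable {dx dy : ℕ}

/-- `(x, y) ↦ h x y` as a function on `ℝ^dx × ℝ^dy` with the Euclidean norm of the pair. -/
def joint (h : Vec dx → Vec dy → ℝ) : WithLp 2 (Vec dx × Vec dy) → ℝ :=
  fun z => h z.fst z.snd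

/-- Partial gradient `∇_x h (x, y)`. -/
def gradX (h : Vec dx → Vec dy → ℝ) (x : Vec dx) (y : Vec dy) : Vec dx :=
  ∇ (fun x' => h x' y) x

/-- Partial gradient `∇_y h (x, y)`. -/
def gradY (h : Vec dx → Vec dy → ℝ) (x : Vec dx) (y : Vec dy) : Vec dy :=
  ∇ (fun y' => h x y') y

/-- `∇_x ∇_y h (x, y)`: the `dx × dy` matrix with entries `∂_{x_i} ∂_{y_j} h`, as an operator
`ℝ^dy → ℝ^dx` (the transpose of the Jacobian of `∇_y h` in `x`). -/
def hessXY (h : Vec dx → Vec dy → ℝ) (x : Vec dx) (y : Vec dy) : Vec dy →L[ℝ] Vec dx :=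
  ContinuousLinearMap.adjoint (fderiv ℝ (fun x' => gradY h x' y) x)

/-- The Hessian `∇_y ∇_y h (x, y)`, as an operator on `ℝ^dy`. -/
def hessYY (h : Vec dx → Vec dy → ℝ) (x : Vec dx) (y : Vec dy) : Vec dy →L[ℝ] Vec dy :=
  fderiv ℝ (fun y' => gradY h x y') y

/-- The lower-level solution `y*(x) = argmin_y g (x, y)`. -/
def yStar (g : Vec dx → Vec dy → ℝ) (x : Vec dx) : Vec dy :=
  Classical.epsilon fun y => IsMinOn (g x) Set.univ y

/-- The objective `Φ(x) = f (x, y*(x))`. -/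
def Phi (f g : Vec dx → Vec dy → ℝ) (x : Vec dx) : ℝ := f x (yStar g x)

/-- `R(x, y, v) = ½ vᵀ ∇_y∇_y g(x, y) v - vᵀ ∇_y f(x, y)`. -/
def linSys (f g : Vec dx → Vec dy → ℝ) (x : Vec dx) (y v : Vec dy) : ℝ :=
  (1 / 2) * inner ℝ v (hessYY g x y v) - inner ℝ v (gradY f x y)

/-- `∇_v R(x, y, v)`. -/
def gradR (f g : Vec dx → Vec dy → ℝ) (x : Vec dx) (y v : Vec dy) : Vec dy :=
  ∇ (fun v' => linSys f g x y v') v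

/-- The hypergradient estimate `∇̄f(x, y, v) = ∇_x f(x, y) - ∇_x∇_y g(x, y) v`. -/
def hyperGrad (f g : Vec dx → Vec dy → ℝ) (x : Vec dx) (y v : Vec dy) : Vec dx :=
  gradX f x y - hessXY g x y v

end Derivatives

section Algorithm

variable {dx dy : ℕ}

/-- The variables and accumulators kept by the single-loop algorithm. -/
structure State (dx dy : ℕ) where
  x : Vec dx
  y : Vec dy
  v : Vec dy
  α : ℝ
  β : ℝ
  γ : ℝ

/-- `φ = max {β, γ}`. -/
def State.φ (s : State dx dy) : ℝ := max s.β s.γ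

/-- One round of S-TFBO. -/
def step (f g : Vec dx → Vec dy → ℝ) (s : State dx dy) : State dx dy :=
  let β' := Real.sqrt (s.β ^ 2 + ‖gradY g s.x s.y‖ ^ 2)
  let γ' := Real.sqrt (s.γ ^ 2 + ‖gradR f g s.x s.y s.v‖ ^ 2)
  let φ' := max β' γ'
  let α' := Real.sqrt (s.α ^ 2 + ‖hyperGrad f g s.x s.y s.v‖ ^ 2)
  { x := s.x - (1 / (α' * φ')) • hyperGrad f g s.x s.y s.v
    y := s.y - (1 / β') • gradY g s.x s.y
    v := s.v - (1 / φ') • gradR f g s.x s.y s.v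
    α := α'
    β := β'
    γ := γ' }

/-- The state of S-TFBO after `t` rounds, started in `init`. -/
def run (f g : Vec dx → Vec dy → ℝ) (init : State dx dy) : ℕ → State dx dy
  | 0 => init
  | t + 1 => step f g (run f g init t)

end Algorithm

/-- The numbers that the constants of the analysis are built from: problem parameters, initial
accumulators, and the norms `G0 = ‖∇_y g(x₀, y₀)‖`, `R0 = ‖∇_v R(x₀, y₀, v₀)‖`. -/
structure Params where
  μ : ℝ
  Lf0 : ℝ
  Lf1 : ℝ
  Lg1 : ℝ
  Lg2 : ℝ
  Cfx : ℝ
  Cfy : ℝ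
  Cgxy : ℝ
  Cgyy : ℝ
  α0 : ℝ
  β0 : ℝ
  γ0 : ℝ
  G0 : ℝ
  R0 : ℝ

/-- `f`, `g` are `C²` and `g` is `μ`-strongly convex in `y`. -/
structure Smooth {dx dy : ℕ} (f g : Vec dx → Vec dy → ℝ) (p : Params) : Prop where
  f_contDiff : ContDiff ℝ 2 (joint f)
  g_contDiff : ContDiff ℝ 2 (joint g)
  g_strongConvex : ∀ x, StrongConvexOn Set.univ p.μ (g x)

/-- Lipschitz continuity of `f`, `∇f`, `∇g`, `∇_x∇_y g` and `∇_y∇_y g` in `(x, y)`, and bounds on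
the first derivatives of `f` and the second derivatives of `g` (in operator norm). -/
structure Lip {dx dy : ℕ} (f g : Vec dx → Vec dy → ℝ) (p : Params) : Prop where
  f_lip : ∀ z w, |joint f z - joint f w| ≤ p.Lf0 * ‖z - w‖
  gradf_lip : ∀ z w, ‖∇ (joint f) z - ∇ (joint f) w‖ ≤ p.Lf1 * ‖z - w‖
  gradg_lip : ∀ z w, ‖∇ (joint g) z - ∇ (joint g) w‖ ≤ p.Lg1 * ‖z - w‖
  hessXY_lip : ∀ z w : WithLp 2 (Vec dx × Vec dy),
    ‖hessXY g z.fst z.snd - hessXY g w.fst w.snd‖ ≤ p.Lg2 * ‖z - w‖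
  hessYY_lip : ∀ z w : WithLp 2 (Vec dx × Vec dy),
    ‖hessYY g z.fst z.snd - hessYY g w.fst w.snd‖ ≤ p.Lg2 * ‖z - w‖
  gradX_bound : ∀ x y, ‖gradX f x y‖ ≤ p.Cfx
  gradY_bound : ∀ x y, ‖gradY f x y‖ ≤ p.Cfy
  hessXY_bound : ∀ x y, ‖hessXY g x y‖ ≤ p.Cgxy
  hessYY_bound : ∀ x y, ‖hessYY g x y‖ ≤ p.Cgyy

namespace Params

variable (p : Params)

def φ0 : ℝ := max p.β0 p.γ0

def Ly : ℝ := p.Cgxy / p.μ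

def Lv : ℝ := (p.Lf1 / p.μ + p.Cfy * p.Lg2 / p.μ ^ 2) * (1 + p.Ly)

def LΦ : ℝ := (p.Lf1 + p.Lg2 * p.Cfy / p.μ) * (1 + p.Cgxy / p.μ) ^ 2

def Lbar : ℝ :=
  max (2 * Real.sqrt (p.Cfy ^ 2 * p.Lg2 ^ 2 / p.μ ^ 2 + p.Lf1 ^ 2)) (Real.sqrt 2 * p.Cgxy)

/-- The recurring quantity `L_{g,2} C_{f_y} / μ + L_{f,1}`. -/
def M : ℝ := p.Lg2 * p.Cfy / p.μ + p.Lf1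

/-- The recurring quantity `(4 (μ + C_{g_yy})² / (μ C_{g_yy}) + 8) M² / μ²`. -/
def κ : ℝ :=
  (4 * (p.μ + p.Cgyy) ^ 2 / (p.μ * p.Cgyy) + 8) * p.M ^ 2 * (1 / p.μ ^ 2)

/-- The expression for `a₀` in terms of `C_β`. -/
def a0Of (Cβ : ℝ) : ℝ :=
  (p.κ + 1) * ((p.μ + p.Lg1) ^ 2 * p.Ly ^ 2 / (p.μ * p.Lg1 * Cβ))
  + 4 * (p.μ + p.Cgyy) * (p.μ + p.Lg1) * p.Ly ^ 2 / (p.μ ^ 3 * p.Lg1 * p.φ0) * p.M ^ 2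
  + 4 * (p.μ + p.Cgyy) ^ 2 * p.Lv ^ 2 / (p.μ * p.Cgyy * p.γ0)

/-- The expression for `C_β` in terms of `C_β` itself, through `a₀`. -/
def CβMap (Cβ : ℝ) : ℝ :=
  max (p.μ + p.Lg1) (max (2 * p.μ * p.Lg1 / (p.μ + p.Lg1))
    (max p.β0 (max (64 * p.a0Of Cβ ^ 2) 1)))

/-- `C_β`: the unique solution of `C = max {μ + L, 2μL/(μ+L), β₀, 64 a₀(C)², 1}`. -/
def Cβ : ℝ := Classical.epsilon fun C => C = p.CβMap C

theorem existsUnique_Cβ (hμ : 0 < p.μ) (hL : 0 < p.Lg1) (hK : 0 < p.Cgyy) (hβ : 0 < p.β0)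
    (hγ : 0 < p.γ0) : ∃! C : ℝ, C = p.CβMap C := by
  have hφ : 0 < p.φ0 := lt_max_of_lt_left hβ
  have hκ : 0 ≤ p.κ := by unfold κ; positivity
  obtain ⟨A, B, hA, hB, hAB⟩ : ∃ A B : ℝ, 0 ≤ A ∧ 0 ≤ B ∧ ∀ C, p.a0Of C = A / C + B := by
    refine ⟨(p.κ + 1) * ((p.μ + p.Lg1) ^ 2 * p.Ly ^ 2 / (p.μ * p.Lg1)),
      4 * (p.μ + p.Cgyy) * (p.μ + p.Lg1) * p.Ly ^ 2 / (p.μ ^ 3 * p.Lg1 * p.φ0) * p.M ^ 2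
      + 4 * (p.μ + p.Cgyy) ^ 2 * p.Lv ^ 2 / (p.μ * p.Cgyy * p.γ0), by positivity,
      by positivity, fun C => ?_⟩
    unfold a0Of
    rw [← div_div, mul_div_assoc (p.κ + 1), add_assoc]
  have anti : ∀ C D : ℝ, 1 ≤ C → C ≤ D → p.CβMap D ≤ p.CβMap C := by
    intro C D hC hCD
    have hC0 : (0 : ℝ) < C := by linarith
    have h0 : A / D ≤ A / C := by gcongr
    have hD : (0 : ℝ) ≤ D := by linarith
    have h1 : 0 ≤ A / D := div_nonneg hA hD
    unfold CβMap
    rw [hAB, hAB]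
    gcongr
  have one_le : ∀ C, 1 ≤ p.CβMap C := fun C => by simp [CβMap]
  have hcont : ContinuousOn (fun C => p.CβMap C - C) (Set.Icc 1 (p.CβMap 1)) := by
    have h2 : ContinuousOn (fun C : ℝ => A / C) (Set.Icc 1 (p.CβMap 1)) :=
      continuousOn_const.div continuousOn_id fun C hC => by
        have : (1 : ℝ) ≤ C := hC.1
        exact ne_of_gt (by linarith)
    have h3 : ContinuousOn (fun C : ℝ => 64 * (A / C + B) ^ 2) (Set.Icc 1 (p.CβMap 1)) :=
      continuousOn_const.mul ((h2.add continuousOn_const).pow 2)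
    refine ContinuousOn.sub ?_ continuousOn_id
    refine continuousOn_const.sup (continuousOn_const.sup
      (continuousOn_const.sup (ContinuousOn.sup ?_ continuousOn_const)))
    simpa only [hAB] using h3
  have hmem : (0 : ℝ) ∈ Set.Icc (p.CβMap (p.CβMap 1) - p.CβMap 1) (p.CβMap 1 - 1) :=
    ⟨by linarith [anti 1 (p.CβMap 1) le_rfl (one_le 1)], by linarith [one_le 1]⟩
  obtain ⟨C, hC, hC0⟩ := intermediate_value_Icc' (one_le 1) hcont hmem
  refine ⟨C, by simp only at hC0 ⊢; linarith, fun D hD => ?_⟩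
  have hCe : C = p.CβMap C := by simp only at hC0; linarith
  have hD1 : 1 ≤ D := hD ▸ one_le D
  rcases le_total C D with h | h
  · exact le_antisymm (by linarith [anti C D hC.1 h]) h
  · exact le_antisymm h (by linarith [anti D C hD1 h])

theorem Cβ_eq (hμ : 0 < p.μ) (hL : 0 < p.Lg1) (hK : 0 < p.Cgyy) (hβ : 0 < p.β0)
    (hγ : 0 < p.γ0) : p.Cβ = p.CβMap p.Cβ :=
  Classical.epsilon_spec (p.existsUnique_Cβ hμ hL hK hβ hγ).exists

def a0 : ℝ := p.a0Of p.Cβ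

def Cα : ℝ := max (2 * p.LΦ / p.φ0) p.α0

def Cγ : ℝ :=
  max (2 * (p.μ + p.Cgyy)) (max (p.μ * p.Cgyy / (p.μ + p.Cgyy))
    (max p.γ0 (max (64 * p.a0 ^ 2) (max 1 p.Cgyy))))

def abar : ℝ := Real.sqrt 2 / p.μ

def bbar : ℝ := Real.sqrt 2 * p.Cfy / p.μ

/-- Bound on `‖y_k - y*(x_k)‖²` at the last `k` with `β_k ≤ C_β`. -/
def Dy : ℝ := p.G0 ^ 2 / p.μ ^ 2 + (p.Cβ / p.μ + p.Ly / p.φ0) ^ 2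

/-- Together with `Dy`, controls `‖v_k - v*(x_k)‖²` at the last `k` with `γ_k ≤ C_γ`. -/
def Dv : ℝ := p.R0 ^ 2 / p.μ ^ 2 + (1 + p.Cγ / p.μ + p.Lv / p.φ0) ^ 2

/-- The recurring quantity `4 (μ + C_{g_yy}) (M² D_y / μ² + D_v)`. -/
def E : ℝ := 4 * (p.μ + p.Cgyy) * (p.M ^ 2 / p.μ ^ 2 * p.Dy + p.Dv)

def b0 : ℝ :=
  p.Cβ + p.Cγ + p.E + p.κ * (p.Cβ ^ 2 / p.β0 - p.β0) + (p.κ + 1) * (p.μ + p.Lg1) * p.Dy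

def a1 : ℝ := 6 * p.a0

def b1 : ℝ :=
  4 * p.a0 * Real.log (p.Cgxy * p.abar + p.Cgxy * p.bbar + p.Cfx + p.α0) + 4 * p.a0 + 2 * p.b0

def c2 : ℝ :=
  2 * Real.log (p.Cgxy * p.abar * p.a1 + p.Cgxy * p.abar * p.b1 + p.Cgxy * p.bbar
    + p.Cfx + p.α0) + 1

/-- The coefficient `(μ + L_{g,1})² L_y² / (μ L_{g,1} C_β)`. -/
def Ay : ℝ := (p.μ + p.Lg1) ^ 2 * p.Ly ^ 2 / (p.μ * p.Lg1 * p.Cβ)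

/-- The coefficient `4(μ+C_{g_yy})(μ+L_{g,1})L_y² M² / (μ³ L_{g,1} φ₀)
+ 4(μ+C_{g_yy})² L_v² / (μ C_{g_yy} C_γ)`. -/
def Av : ℝ :=
  4 * (p.μ + p.Cgyy) * (p.μ + p.Lg1) * p.Ly ^ 2 / (p.μ ^ 3 * p.Lg1 * p.φ0) * p.M ^ 2
  + 4 * (p.μ + p.Cgyy) ^ 2 * p.Lv ^ 2 / (p.μ * p.Cgyy * p.Cγ)

/-- `b₂` as a function of `c₂`. -/
def b2Of (c : ℝ) : ℝ := p.Ay * c + (p.Cβ ^ 2 / p.β0 - p.β0 + (p.μ + p.Lg1) * p.Dy)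

/-- `b₃` as a function of `c₂`. -/
def b3Of (c : ℝ) : ℝ :=
  p.Cγ ^ 2 / p.γ0 - p.γ0 + p.E + p.Av * c + p.κ * p.b2Of c

def a2 : ℝ := 5 * p.Ay

def b2 : ℝ := p.b2Of p.c2

def a3 : ℝ := 5 * p.Av + p.κ * p.a2

def b3 : ℝ := p.b3Of p.c2

def a4 : ℝ :=
  2 * p.Lbar ^ 2 * p.a2 / (p.μ ^ 2 * p.Cα) * (1 + 2 / p.μ ^ 2 * p.M ^ 2)
  + 4 * p.Lbar ^ 2 * p.a3 / (p.μ ^ 2 * p.Cα)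

/-- The rounds with `α_k ≤ C_α` contribute the terms with `c₁ = 2 log (C_α / α₀)`. -/
def b4 : ℝ :=
  2 * p.Lbar ^ 2 / p.μ ^ 2 * (1 + 2 / p.μ ^ 2 * p.M ^ 2)
    * (p.b2 / p.Cα + p.b2Of (2 * Real.log (p.Cα / p.α0)) / p.α0)
  + 4 * p.Lbar ^ 2 / p.μ ^ 2
    * (p.b3 / p.Cα + p.b3Of (2 * Real.log (p.Cα / p.α0)) / p.α0)
  + 2 * p.LΦ / p.φ0 ^ 2 * (p.Cα ^ 2 / p.α0 ^ 2)

end Params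

end

end STFBO

/-! The accumulators feed on one another, and the theorem says that this loop closes at a
logarithmic rate. Let `S_n = Σ_{k<n} ‖∇̄f‖² / α_{k+1}²` (`ratioSum`), which measures how far the
targets `y*(x)` and `v*(x)` drift. Once `β` exceeds `C_β`, strong convexity makes a `y`-step
decrease the distance to `y*` up to that drift, so `Σ ‖∇_y g‖²/β` is at most a constant plus a
multiple of `S_n`. The `v`-step is an inexact gradient step on a quadratic and behaves alike, its
error being paid for by the sum for `y`. Rounds before a threshold is passed are bounded crudely,
since the accumulator is still below a constant. Together this gives `φ_n ≤ b₀ + a₀ S_n`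
(`Trajectory.φ_le`).

Conversely `S_n ≤ 2 log α_n` (`Accumulates.sum_div_sq_le_log`), and `α_n` is at most a constant plus
multiples of `√n` and `φ_n` (`Trajectory.α_le`). Hence `φ_n ≤ const + a₀ log n + 2 a₀ log φ_n` when
`φ_n ≥ C_β`, and `C_β ≥ 64 a₀²` lets `φ_n / 2` absorb the last term (`Trajectory.φ_le_log`). Then
`α_n = O(n)`, so `S_n` and with it all the sums are logarithmic.

For `α`, the function `Φ` has the Lipschitz gradient `∇̄f(x, y*, v*)`, so each round decreases `Φ`
up to the error of the estimate `∇̄f(x, y, v)`, which the two residuals control, and a curvature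
term, which is absorbed once `α > C_α`. Telescoping bounds `Σ ‖∇̄f‖²/(α φ)` after that moment, and
multiplying by `φ_n` bounds the growth of `α` (`Trajectory.α_le_log`).

The link between the algorithm and these scalar arguments is `trajectory_run`. -/

namespace STFBO

/-! ### Partial gradients and Hessians as parts of joint derivatives. -/

section Joint

variable {dx dy : ℕ}

instance : ContinuousSMul ℝ (WithLp 2 (Vec dx × Vec dy)) := IsBoundedSMul.continuousSMul

/-- The point `(x, y)` of `ℝ^dx × ℝ^dy` with the Euclidean norm. -/
abbrev pt (x : Vec dx) (y : Vec dy) : WithLp 2 (Vec dx × Vec dy) := WithLp.toLp 2 (x, y)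

theorem norm_pt_le (x : Vec dx) (y : Vec dy) : ‖pt x y‖ ≤ ‖x‖ + ‖y‖ := by
  have h := WithLp.prod_norm_sq_eq_of_L2 (pt x y)
  have h1 : (pt x y).fst = x := rfl
  have h2 : (pt x y).snd = y := rfl
  rw [h1, h2] at h
  refine abs_le_of_sq_le_sq' ?_ (by positivity) |>.2
  nlinarith [norm_nonneg x, norm_nonneg y, mul_nonneg (norm_nonneg x) (norm_nonneg y)]

theorem norm_pt_sub_pt_le (x x' : Vec dx) (y y' : Vec dy) :
    ‖pt x y - pt x' y'‖ ≤ ‖x - x'‖ + ‖y - y'‖ :=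
  norm_pt_le (x - x') (y - y')

theorem norm_pt_sub_pt_left_le (x : Vec dx) (y y' : Vec dy) :
    ‖pt x y - pt x y'‖ ≤ ‖y - y'‖ := by
  simpa using norm_pt_sub_pt_le x x y y'

theorem norm_fst_le (z : WithLp 2 (Vec dx × Vec dy)) : ‖z.fst‖ ≤ ‖z‖ := by
  have h := WithLp.prod_norm_sq_eq_of_L2 z
  refine abs_le_of_sq_le_sq' ?_ (by positivity) |>.2
  nlinarith [sq_nonneg ‖z.snd‖]

theorem norm_snd_le (z : WithLp 2 (Vec dx × Vec dy)) : ‖z.snd‖ ≤ ‖z‖ := by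
  have h := WithLp.prod_norm_sq_eq_of_L2 z
  refine abs_le_of_sq_le_sq' ?_ (by positivity) |>.2
  nlinarith [sq_nonneg ‖z.fst‖]

/-- The linear embedding `u ↦ (u, 0)`. -/
noncomputable def inlL (dx dy : ℕ) : Vec dx →L[ℝ] WithLp 2 (Vec dx × Vec dy) :=
  (WithLp.prodContinuousLinearEquiv 2 ℝ (Vec dx) (Vec dy)).symm.toContinuousLinearMap.comp
    (ContinuousLinearMap.inl ℝ (Vec dx) (Vec dy))

/-- The linear embedding `w ↦ (0, w)`. -/
noncomputable def inrL (dx dy : ℕ) : Vec dy →L[ℝ] WithLp 2 (Vec dx × Vec dy) :=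
  (WithLp.prodContinuousLinearEquiv 2 ℝ (Vec dx) (Vec dy)).symm.toContinuousLinearMap.comp
    (ContinuousLinearMap.inr ℝ (Vec dx) (Vec dy))

theorem inlL_apply (u : Vec dx) : inlL dx dy u = pt u 0 := rfl

theorem inrL_apply (w : Vec dy) : inrL dx dy w = pt 0 w := rfl

theorem pt_eq_left (x : Vec dx) (y : Vec dy) : pt x y = inlL dx dy x + pt 0 y := by
  rw [inlL_apply, ← WithLp.toLp_add]; simp

theorem pt_eq_right (x : Vec dx) (y : Vec dy) : pt x y = pt x 0 + inrL dx dy y := by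
  rw [inrL_apply, ← WithLp.toLp_add]; simp

theorem hasFDerivAt_pt_left (x : Vec dx) (y : Vec dy) :
    HasFDerivAt (fun x' => pt x' y) (inlL dx dy) x := by
  rw [show (fun x' => pt x' y) = fun x' => inlL dx dy x' + pt 0 y from
    funext fun x' => pt_eq_left x' y]
  exact (inlL dx dy).hasFDerivAt.add_const _

theorem hasFDerivAt_pt_right (x : Vec dx) (y : Vec dy) :
    HasFDerivAt (fun y' => pt x y') (inrL dx dy) y := by
  rw [show (fun y' => pt x y') = fun y' => pt x 0 + inrL dx dy y' from
    funext fun y' => pt_eq_right x y']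
  exact (inrL dx dy).hasFDerivAt.const_add _

theorem contDiff_pt_right (x : Vec dx) {n : WithTop ℕ∞} :
    ContDiff ℝ n (fun y : Vec dy => pt x y) := by
  rw [show (fun y' => pt x y') = fun y' => pt x 0 + inrL dx dy y' from
    funext fun y' => pt_eq_right x y']
  exact contDiff_const.add (inrL dx dy).contDiff

variable {h : Vec dx → Vec dy → ℝ}

theorem hasGradientAt_left (hh : Differentiable ℝ (joint h)) (x : Vec dx) (y : Vec dy) :
    HasGradientAt (fun x' => h x' y) (∇ (joint h) (pt x y)).fst x := by
  have h1 := (hh (pt x y)).hasGradientAt.hasFDerivAt.comp x (hasFDerivAt_pt_left x y)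
  rw [hasGradientAt_iff_hasFDerivAt]
  refine h1.congr_fderiv ?_
  ext1 u
  simp only [ContinuousLinearMap.comp_apply, inlL_apply, InnerProductSpace.toDual_apply_apply,
    WithLp.prod_inner_apply]
  simp

theorem hasGradientAt_right (hh : Differentiable ℝ (joint h)) (x : Vec dx) (y : Vec dy) :
    HasGradientAt (fun y' => h x y') (∇ (joint h) (pt x y)).snd y := by
  have h1 := (hh (pt x y)).hasGradientAt.hasFDerivAt.comp y (hasFDerivAt_pt_right x y)
  rw [hasGradientAt_iff_hasFDerivAt]
  refine h1.congr_fderiv ?_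
  ext1 u
  simp only [ContinuousLinearMap.comp_apply, inrL_apply, InnerProductSpace.toDual_apply_apply,
    WithLp.prod_inner_apply]
  simp

theorem gradX_eq (hh : Differentiable ℝ (joint h)) (x : Vec dx) (y : Vec dy) :
    gradX h x y = (∇ (joint h) (pt x y)).fst :=
  (hasGradientAt_left hh x y).gradient

theorem gradY_eq (hh : Differentiable ℝ (joint h)) (x : Vec dx) (y : Vec dy) :
    gradY h x y = (∇ (joint h) (pt x y)).snd :=
  (hasGradientAt_right hh x y).gradient

theorem hasGradientAt_gradY (hh : Differentiable ℝ (joint h)) (x : Vec dx) (y : Vec dy) :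
    HasGradientAt (fun y' => h x y') (gradY h x y) y := by
  rw [gradY_eq hh]
  exact hasGradientAt_right hh x y

theorem fderiv_joint_apply (hh : Differentiable ℝ (joint h)) (x : Vec dx) (y : Vec dy)
    (z : WithLp 2 (Vec dx × Vec dy)) :
    fderiv ℝ (joint h) (pt x y) z
      = inner ℝ (gradX h x y) z.fst + inner ℝ (gradY h x y) z.snd := by
  rw [gradX_eq hh, gradY_eq hh, (hh (pt x y)).hasGradientAt.hasFDerivAt.fderiv,
    InnerProductSpace.toDual_apply_apply, WithLp.prod_inner_apply]
  rfl

theorem norm_gradX_sub_le (hh : Differentiable ℝ (joint h)) {C : ℝ}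
    (hC : ∀ z w, ‖∇ (joint h) z - ∇ (joint h) w‖ ≤ C * ‖z - w‖) (x x' : Vec dx) (y y' : Vec dy) :
    ‖gradX h x y - gradX h x' y'‖ ≤ C * ‖pt x y - pt x' y'‖ := by
  rw [gradX_eq hh, gradX_eq hh, ← WithLp.sub_fst]
  exact (norm_fst_le _).trans (hC _ _)

theorem norm_gradY_sub_le (hh : Differentiable ℝ (joint h)) {C : ℝ}
    (hC : ∀ z w, ‖∇ (joint h) z - ∇ (joint h) w‖ ≤ C * ‖z - w‖) (x x' : Vec dx) (y y' : Vec dy) :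
    ‖gradY h x y - gradY h x' y'‖ ≤ C * ‖pt x y - pt x' y'‖ := by
  rw [gradY_eq hh, gradY_eq hh, ← WithLp.sub_snd]
  exact (norm_snd_le _).trans (hC _ _)

/-- `∇_y h` is the image of the C¹ map `fderiv ℝ (joint h)` under a fixed linear map: restriction to
the `y`-directions followed by the Riesz isomorphism. -/
theorem differentiable_gradY (hh : ContDiff ℝ 2 (joint h)) :
    Differentiable ℝ (fun z : WithLp 2 (Vec dx × Vec dy) => gradY h z.fst z.snd) := by
  have h1 : Differentiable ℝ (fderiv ℝ (joint h)) :=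
    (hh.fderiv_right (m := 1) (by norm_num)).differentiable (by norm_num)
  have h2 : (fun z : WithLp 2 (Vec dx × Vec dy) => gradY h z.fst z.snd)
      = fun z => (InnerProductSpace.toDual ℝ (Vec dy)).symm
          ((fderiv ℝ (joint h) z).comp (inrL dx dy)) := by
    funext z
    have h3 := (hh.differentiable (by norm_num) (pt z.fst z.snd)).hasFDerivAt.comp z.snd
      (hasFDerivAt_pt_right z.fst z.snd)
    exact congrArg _ h3.fderiv
  rw [h2]
  have h4 : Differentiable ℝ fun z => (fderiv ℝ (joint h) z).comp (inrL dx dy) :=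
    h1.clm_comp (differentiable_const _)
  exact (InnerProductSpace.toDual ℝ
    (Vec dy)).symm.toContinuousLinearEquiv.toContinuousLinearMap.differentiable.comp h4

theorem hasFDerivAt_gradY_left (hh : ContDiff ℝ 2 (joint h)) (x : Vec dx) (y : Vec dy) :
    HasFDerivAt (fun x' => gradY h x' y) (fderiv ℝ (fun x' => gradY h x' y) x) x := by
  have hd := ((differentiable_gradY hh) (pt x y)).hasFDerivAt.comp x (hasFDerivAt_pt_left x y)
  exact hd.differentiableAt.hasFDerivAt

theorem hasFDerivAt_gradY_right (hh : ContDiff ℝ 2 (joint h)) (x : Vec dx) (y : Vec dy) :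
    HasFDerivAt (fun y' => gradY h x y') (hessYY h x y) y := by
  have hd := ((differentiable_gradY hh) (pt x y)).hasFDerivAt.comp y (hasFDerivAt_pt_right x y)
  exact hd.differentiableAt.hasFDerivAt

/-- The derivative of `∇_y h` along a joint direction. -/
theorem fderiv_gradY_apply (hh : ContDiff ℝ 2 (joint h)) (x : Vec dx) (y : Vec dy)
    (z : WithLp 2 (Vec dx × Vec dy)) :
    fderiv ℝ (fun z : WithLp 2 (Vec dx × Vec dy) => gradY h z.fst z.snd) (pt x y) z
      = ContinuousLinearMap.adjoint (hessXY h x y) z.fst + hessYY h x y z.snd := by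
  have hd := ((differentiable_gradY hh) (pt x y)).hasFDerivAt
  have h1 := (hd.comp x (hasFDerivAt_pt_left x y)).fderiv
  have h2 := (hd.comp y (hasFDerivAt_pt_right x y)).fderiv
  have hz : z = inlL dx dy z.fst + inrL dx dy z.snd := by
    rw [inlL_apply, inrL_apply, ← WithLp.toLp_add]; simp; rfl
  have e1 : ContinuousLinearMap.adjoint (hessXY h x y) = fderiv ℝ (fun x' => gradY h x' y) x := by
    simp [hessXY]
  rw [e1]
  conv_lhs => rw [hz, map_add]
  congr 1
  · exact (congrArg (fun A => A z.fst) h1).symm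
  · exact (congrArg (fun A => A z.snd) h2).symm

/-- Symmetry of second derivatives for the slice `h x`, carried over by the Riesz isomorphism. -/
theorem inner_hessYY_comm (hh : ContDiff ℝ 2 (joint h)) (x : Vec dx) (y v w : Vec dy) :
    inner ℝ (hessYY h x y v) w = inner ℝ v (hessYY h x y w) := by
  have hc : ContDiff ℝ 2 (fun y' => h x y') := hh.comp (contDiff_pt_right x)
  have hs : IsSymmSndFDerivAt ℝ (fun y' => h x y') y :=
    hc.contDiffAt.isSymmSndFDerivAt (by simp)
  have hf : fderiv ℝ (fun y' => h x y')
      = fun y' => InnerProductSpace.toDual ℝ (Vec dy) (gradY h x y') := by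
    funext y'
    exact (hasGradientAt_gradY (hh.differentiable (by norm_num)) x y').hasFDerivAt.fderiv
  have hd : HasFDerivAt (fderiv ℝ (fun y' => h x y'))
      ((InnerProductSpace.toDual ℝ (Vec dy)).toContinuousLinearEquiv.toContinuousLinearMap.comp
        (hessYY h x y)) y := by
    rw [hf]
    exact ((InnerProductSpace.toDual ℝ
      (Vec dy)).toContinuousLinearEquiv.toContinuousLinearMap.hasFDerivAt).comp
      y (hasFDerivAt_gradY_right hh x y)
  have := hs v w
  rw [hd.fderiv] at this
  rw [real_inner_comm _ v]
  simpa using this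

end Joint

/-! ### Symmetric operators with bounded spectrum, and the gradient step. -/

section LinearAlgebra

variable {E : Type*} [NormedAddCommGroup E] [InnerProductSpace ℝ E]

/-- This is `A² ≤ K A` for `0 ≤ A ≤ K`. No square root of `A` is needed: positivity of the form at
`v - t • A v` with `t = 1 / K` gives it. -/
theorem norm_sq_apply_le_of_symm {A : E →L[ℝ] E} (hs : ∀ v w, inner ℝ (A v) w = inner ℝ v (A w))
    (hp : ∀ v, 0 ≤ inner ℝ (A v) v) {K : ℝ} (hK : ∀ v, inner ℝ (A v) v ≤ K * ‖v‖ ^ 2) (v : E) :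
    ‖A v‖ ^ 2 ≤ K * inner ℝ (A v) v := by
  -- nonnegativity of the form at `v - t A v`
  have key : ∀ t : ℝ, 0 ≤ inner ℝ (A v) v - 2 * t * ‖A v‖ ^ 2
      + t ^ 2 * inner ℝ (A (A v)) (A v) := by
    intro t
    have h := hp (v - t • A v)
    have e : inner ℝ (A (v - t • A v)) (v - t • A v)
        = inner ℝ (A v) v - 2 * t * ‖A v‖ ^ 2 + t ^ 2 * inner ℝ (A (A v)) (A v) := by
      have h2 : inner ℝ (A (A v)) v = ‖A v‖ ^ 2 := by
        rw [hs, real_inner_self_eq_norm_sq]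
      simp only [map_sub, map_smul, inner_sub_left, inner_sub_right, real_inner_smul_left,
        real_inner_smul_right, h2, real_inner_self_eq_norm_sq]
      ring
    rwa [e] at h
  have h1 := hK (A v)
  have h2 := hp v
  by_cases h0 : ‖A v‖ = 0
  · rw [h0]
    have h3 : A v = 0 := norm_eq_zero.1 h0
    simp [h3]
  have h0' : 0 < ‖A v‖ ^ 2 := by positivity
  have hK0 : 0 ≤ K := by
    by_contra hneg
    have := hp (A v)
    nlinarith
  rcases hK0.eq_or_lt with hK0 | hK0
  · exfalso
    subst hK0
    have h3 := hK v
    have h4 := key 1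
    nlinarith
  · have h3 := key (1 / K)
    have h4 : (1 / K) ^ 2 * inner ℝ (A (A v)) (A v) ≤ (1 / K) * ‖A v‖ ^ 2 := by
      calc (1 / K) ^ 2 * inner ℝ (A (A v)) (A v) ≤ (1 / K) ^ 2 * (K * ‖A v‖ ^ 2) := by gcongr
        _ = (1 / K) * ‖A v‖ ^ 2 := by field_simp
    have h5 : (1 / K) * ‖A v‖ ^ 2 ≤ inner ℝ (A v) v := by linarith
    calc ‖A v‖ ^ 2 = K * ((1 / K) * ‖A v‖ ^ 2) := by field_simp
      _ ≤ _ := by gcongr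

/-- Coercivity of a symmetric operator with spectrum in `[m, K]`. -/
theorem mul_norm_sq_add_norm_sq_apply_le {A : E →L[ℝ] E}
    (hs : ∀ v w, inner ℝ (A v) w = inner ℝ v (A w)) {m K : ℝ}
    (hm : ∀ v, m * ‖v‖ ^ 2 ≤ inner ℝ (A v) v) (hK : ∀ v, inner ℝ (A v) v ≤ K * ‖v‖ ^ 2) (v : E) :
    m * K * ‖v‖ ^ 2 + ‖A v‖ ^ 2 ≤ (m + K) * inner ℝ (A v) v := by
  have e : ∀ w, inner ℝ ((A - m • ContinuousLinearMap.id ℝ E) w) w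
      = inner ℝ (A w) w - m * ‖w‖ ^ 2 := fun w => by
    simp [inner_sub_left, real_inner_smul_left]
  -- The operator `A - m` lies between `0` and `K - m`; expanding its inequality gives the claim.
  have h := norm_sq_apply_le_of_symm (A := A - m • ContinuousLinearMap.id ℝ E) (K := K - m)
    (fun v w => by simp [inner_sub_left, inner_sub_right, real_inner_smul_left,
      real_inner_smul_right, hs]) (fun w => by rw [e]; linarith [hm w])
    (fun w => by rw [e]; linarith [hK w]) v
  rw [e] at h
  have e2 : ‖(A - m • ContinuousLinearMap.id ℝ E) v‖ ^ 2
      = ‖A v‖ ^ 2 - 2 * m * inner ℝ (A v) v + m ^ 2 * ‖v‖ ^ 2 := by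
    have : (A - m • ContinuousLinearMap.id ℝ E) v = A v - m • v := by simp
    rw [this, norm_sub_sq_real, real_inner_smul_right, norm_smul, mul_pow, Real.norm_eq_abs,
      sq_abs]
    ring
  rw [e2] at h
  linarith

theorem mul_norm_le_of_inner {m : ℝ} {v w : E} (hm : m * ‖v‖ ^ 2 ≤ inner ℝ w v) :
    m * ‖v‖ ≤ ‖w‖ := by
  rcases (norm_nonneg v).eq_or_lt with h0 | h0
  · rw [← h0]; simp
  · have := real_inner_le_norm w v
    refine le_of_mul_le_mul_right ?_ h0
    nlinarith

/-- The distance to the root after a gradient step. -/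
theorem norm_sub_smul_sq_le {e G : E} {m K η : ℝ} (hmK : 0 < m + K) (hη : 0 ≤ η)
    (h : m * K * ‖e‖ ^ 2 + ‖G‖ ^ 2 ≤ (m + K) * inner ℝ G e) :
    ‖e - η • G‖ ^ 2 ≤ (1 - 2 * η * (m * K) / (m + K)) * ‖e‖ ^ 2
      + η * (η - 2 / (m + K)) * ‖G‖ ^ 2 := by
  rw [norm_sub_sq_real, real_inner_smul_right, norm_smul, mul_pow, Real.norm_eq_abs, sq_abs,
    real_inner_comm]
  have h2 : (m * K * ‖e‖ ^ 2 + ‖G‖ ^ 2) / (m + K) ≤ inner ℝ G e := by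
    rw [div_le_iff₀ hmK]; linarith
  have h3 := mul_le_mul_of_nonneg_left h2 (by positivity : 0 ≤ 2 * η)
  have h4 : 2 * η * ((m * K * ‖e‖ ^ 2 + ‖G‖ ^ 2) / (m + K))
      = 2 * η * (m * K) / (m + K) * ‖e‖ ^ 2 + η * (2 / (m + K)) * ‖G‖ ^ 2 := by ring
  nlinarith

end LinearAlgebra

/-! ### Second-order bounds from an affine bound on the derivative. -/

section OneDim

/-- After subtraction of `a s + b s² / 2` the function is monotone on `[0, 1]`. This serves the
quadratic lower bound for `g`, and its mirror image the descent inequality for `Φ`. -/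
theorem add_half_le_of_deriv {p p' : ℝ → ℝ} (hp : ∀ s, HasDerivAt p (p' s) s) {a b : ℝ}
    (h : ∀ s, 0 ≤ s → s ≤ 1 → a + b * s ≤ p' s) : p 0 + a + b / 2 ≤ p 1 := by
  have hq : ∀ s, HasDerivAt (fun s => p s - (a * s + b / 2 * s ^ 2)) (p' s - (a + b * s)) s := by
    intro s
    refine ((hp s).sub (((hasDerivAt_id s).const_mul a).add
      (((hasDerivAt_id s).pow 2).const_mul (b / 2)))).congr_deriv ?_
    simp only [id_eq]; ring
  have hm : MonotoneOn (fun s => p s - (a * s + b / 2 * s ^ 2)) (Set.Icc 0 1) := by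
    refine monotoneOn_of_deriv_nonneg (convex_Icc 0 1)
      (fun s _ => (hq s).continuousAt.continuousWithinAt)
      (fun s _ => (hq s).differentiableAt.differentiableWithinAt) fun s hs => ?_
    rw [interior_Icc] at hs
    rw [(hq s).deriv]
    linarith [h s hs.1.le hs.2.le]
  have := hm (Set.left_mem_Icc.2 zero_le_one) (Set.right_mem_Icc.2 zero_le_one) zero_le_one
  simp only at this
  linarith

theorem le_add_half_of_deriv {p p' : ℝ → ℝ} (hp : ∀ s, HasDerivAt p (p' s) s) {a b : ℝ}
    (h : ∀ s, 0 ≤ s → s ≤ 1 → p' s ≤ a + b * s) : p 1 ≤ p 0 + a + b / 2 := by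
  have := add_half_le_of_deriv (p := fun s => - p s) (p' := fun s => - p' s) (a := -a) (b := -b)
    (fun s => (hp s).neg) (fun s h0 h1 => by linarith [h s h0 h1])
  linarith

end OneDim

/-! ### The strongly convex lower-level problem and its solution `y*`. -/

section LowerLevel

variable {dx dy : ℕ} {f g : Vec dx → Vec dy → ℝ} {p : Params}

theorem Smooth.differentiable_f (hs : Smooth f g p) : Differentiable ℝ (joint f) :=
  hs.f_contDiff.differentiable (by norm_num)

theorem Smooth.differentiable_g (hs : Smooth f g p) : Differentiable ℝ (joint g) :=
  hs.g_contDiff.differentiable (by norm_num)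

theorem hasDerivAt_line {h : Vec dx → Vec dy → ℝ} (hh : Differentiable ℝ (joint h)) (x : Vec dx)
    (y w : Vec dy) (s : ℝ) :
    HasDerivAt (fun s : ℝ => h x (y + s • w)) (inner ℝ (gradY h x (y + s • w)) w) s := by
  have h1 : HasDerivAt (fun s : ℝ => y + s • w) w s := by
    simpa using ((hasDerivAt_id s).smul_const w).const_add y
  have h2 := (hasGradientAt_gradY hh x (y + s • w)).hasFDerivAt.comp_hasDerivAt s h1
  rw [InnerProductSpace.toDual_apply_apply] at h2
  exact h2

theorem hasDerivAt_gradY_line {h : Vec dx → Vec dy → ℝ} (hh : ContDiff ℝ 2 (joint h)) (x : Vec dx)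
    (y w : Vec dy) (s : ℝ) :
    HasDerivAt (fun s : ℝ => gradY h x (y + s • w)) (hessYY h x (y + s • w) w) s := by
  have h1 : HasDerivAt (fun s : ℝ => y + s • w) w s := by
    simpa using ((hasDerivAt_id s).smul_const w).const_add y
  exact (hasFDerivAt_gradY_right hh x (y + s • w)).comp_hasDerivAt s h1

/-- Along a line the derivative of the convex function `g x - μ/2 ‖·‖²` is monotone, so its own
derivative at `0`, which is the difference of the two sides, is nonnegative. -/
theorem Smooth.mul_norm_sq_le_inner_hessYY (hs : Smooth f g p) (x : Vec dx) (y w : Vec dy) :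
    p.μ * ‖w‖ ^ 2 ≤ inner ℝ (hessYY g x y w) w := by
  have hconv := strongConvexOn_iff_convex.1 (hs.g_strongConvex x)
  -- the restriction of the convex function to the line through `y` along `w`
  have hq : ConvexOn ℝ Set.univ
      (fun s : ℝ => g x (y + s • w) - p.μ / 2 * ‖y + s • w‖ ^ 2) := by
    have := hconv.comp_affineMap (AffineMap.lineMap y (y + w) : ℝ →ᵃ[ℝ] Vec dy)
    simpa [Function.comp_def, AffineMap.lineMap_apply, add_comm] using this
  have hd : ∀ s : ℝ, HasDerivAt (fun s : ℝ => g x (y + s • w) - p.μ / 2 * ‖y + s • w‖ ^ 2)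
      (inner ℝ (gradY g x (y + s • w)) w - p.μ * inner ℝ (y + s • w) w) s := by
    intro s
    have h1 : HasDerivAt (fun s : ℝ => y + s • w) w s := by
      simpa using ((hasDerivAt_id s).smul_const w).const_add y
    refine ((hasDerivAt_line hs.differentiable_g x y w s).sub
      (h1.norm_sq.const_mul (p.μ / 2))).congr_deriv ?_
    ring
  have hmono := hq.monotoneOn_deriv (fun s _ => (hd s).differentiableAt)
  rw [monotoneOn_univ, show deriv (fun s : ℝ => g x (y + s • w) - p.μ / 2 * ‖y + s • w‖ ^ 2)
    = fun s => inner ℝ (gradY g x (y + s • w)) w - p.μ * inner ℝ (y + s • w) w from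
    funext fun s => (hd s).deriv] at hmono
  have h1 : HasDerivAt (fun s : ℝ => y + s • w) w 0 := by
    simpa using ((hasDerivAt_id (0 : ℝ)).smul_const w).const_add y
  have h2 : HasDerivAt
      (fun s : ℝ => inner ℝ (gradY g x (y + s • w)) w - p.μ * inner ℝ (y + s • w) w)
      (inner ℝ (hessYY g x y w) w - p.μ * ‖w‖ ^ 2) 0 := by
    have h3 := ((hasDerivAt_gradY_line hs.g_contDiff x y w 0).inner ℝ (hasDerivAt_const 0 w)).sub
      ((h1.inner ℝ (hasDerivAt_const 0 w)).const_mul p.μ)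
    refine h3.congr_deriv ?_
    simp
  linarith [h2.nonneg_of_monotone hmono]

theorem Lip.inner_hessYY_le_Cgyy (hl : Lip f g p) (x : Vec dx) (y w : Vec dy) :
    inner ℝ (hessYY g x y w) w ≤ p.Cgyy * ‖w‖ ^ 2 := by
  calc inner ℝ (hessYY g x y w) w ≤ ‖hessYY g x y w‖ * ‖w‖ := real_inner_le_norm _ _
    _ ≤ (p.Cgyy * ‖w‖) * ‖w‖ := by
        gcongr
        exact (hessYY g x y).le_of_opNorm_le (hl.hessYY_bound x y) w
    _ = _ := by ring

theorem Lip.norm_gradY_g_sub_le (hs : Smooth f g p) (hl : Lip f g p) (hL : 0 ≤ p.Lg1) (x : Vec dx)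
    (y y' : Vec dy) :
    ‖gradY g x y - gradY g x y'‖ ≤ p.Lg1 * ‖y - y'‖ :=
  (norm_gradY_sub_le hs.differentiable_g hl.gradg_lip x x y y').trans
    (mul_le_mul_of_nonneg_left (norm_pt_sub_pt_left_le x y y') hL)

/-- Both `Lg1` and `Cgyy` bound the same Hessian: the `y`-steps are analysed with the former, the
`v`-steps with the latter. -/
theorem Lip.inner_hessYY_le_Lg1 (hs : Smooth f g p) (hl : Lip f g p) (hL : 0 ≤ p.Lg1) (x : Vec dx)
    (y w : Vec dy) : inner ℝ (hessYY g x y w) w ≤ p.Lg1 * ‖w‖ ^ 2 := by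
  have hn : ‖hessYY g x y‖ ≤ p.Lg1 :=
    (hasFDerivAt_gradY_right hs.g_contDiff x y).le_of_lipschitz (C := ⟨p.Lg1, hL⟩)
      (LipschitzWith.of_dist_le_mul fun a b => by
        rw [dist_eq_norm, dist_eq_norm]
        exact hl.norm_gradY_g_sub_le hs hL x a b)
  calc inner ℝ (hessYY g x y w) w ≤ ‖hessYY g x y w‖ * ‖w‖ := real_inner_le_norm _ _
    _ ≤ (p.Lg1 * ‖w‖) * ‖w‖ := by
        gcongr
        exact (hessYY g x y).le_of_opNorm_le hn w
    _ = _ := by ring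

theorem exists_vec_norm_pos (hdy : 0 < dy) : ∃ w : Vec dy, 0 < ‖w‖ :=
  ⟨EuclideanSpace.single ⟨0, hdy⟩ 1, by simp⟩

/-- No sign is assumed of the Lipschitz constants. Since `dy > 0` there are two distinct points, and
they force it. -/
theorem nonneg_of_lip {E : Type*} [SeminormedAddCommGroup E]
    {F : WithLp 2 (Vec dx × Vec dy) → E} (hdy : 0 < dy) {C : ℝ}
    (hC : ∀ z w, ‖F z - F w‖ ≤ C * ‖z - w‖) : 0 ≤ C := by
  obtain ⟨w, hw⟩ := exists_vec_norm_pos hdy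
  have h1 := (norm_nonneg _).trans (hC (pt 0 w) 0)
  have h2 : 0 < ‖pt (0 : Vec dx) w - 0‖ := by
    rw [sub_zero]
    exact hw.trans_le (norm_snd_le (pt (0 : Vec dx) w))
  exact nonneg_of_mul_nonneg_left h1 h2

theorem Lip.Lf1_nonneg (hl : Lip f g p) (hdy : 0 < dy) : 0 ≤ p.Lf1 := nonneg_of_lip hdy hl.gradf_lip

theorem Lip.Lg1_nonneg (hl : Lip f g p) (hdy : 0 < dy) : 0 ≤ p.Lg1 := nonneg_of_lip hdy hl.gradg_lip

theorem Lip.Lg2_nonneg (hl : Lip f g p) (hdy : 0 < dy) : 0 ≤ p.Lg2 :=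
  nonneg_of_lip hdy hl.hessYY_lip

theorem Lip.Cfx_nonneg (hl : Lip f g p) : 0 ≤ p.Cfx := (norm_nonneg _).trans (hl.gradX_bound 0 0)

theorem Lip.Cfy_nonneg (hl : Lip f g p) : 0 ≤ p.Cfy := (norm_nonneg _).trans (hl.gradY_bound 0 0)

theorem Lip.Cgxy_nonneg (hl : Lip f g p) : 0 ≤ p.Cgxy :=
  (norm_nonneg _).trans (hl.hessXY_bound 0 0)

theorem Lip.μ_le_Cgyy (hs : Smooth f g p) (hl : Lip f g p) (hdy : 0 < dy) : p.μ ≤ p.Cgyy := by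
  obtain ⟨w, hw⟩ := exists_vec_norm_pos hdy
  exact le_of_mul_le_mul_right ((hs.mul_norm_sq_le_inner_hessYY 0 0 w).trans
    (hl.inner_hessYY_le_Cgyy 0 0 w)) (by positivity)

theorem Lip.μ_le_Lg1 (hs : Smooth f g p) (hl : Lip f g p) (hdy : 0 < dy) : p.μ ≤ p.Lg1 := by
  obtain ⟨w, hw⟩ := exists_vec_norm_pos hdy
  exact le_of_mul_le_mul_right ((hs.mul_norm_sq_le_inner_hessYY 0 0 w).trans
    (hl.inner_hessYY_le_Lg1 hs (hl.Lg1_nonneg hdy) 0 0 w)) (by positivity)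

/-- `∇_y g` along a segment is given by the mean of the Hessians. -/
theorem exists_mean_hessYY (hs : Smooth f g p) (hl : Lip f g p) (hL : 0 ≤ p.Lg1)
    (x : Vec dx) (y y' : Vec dy) :
    ∃ A : Vec dy →L[ℝ] Vec dy, gradY g x y - gradY g x y' = A (y - y') ∧
      (∀ v w, inner ℝ (A v) w = inner ℝ v (A w)) ∧
      (∀ v, p.μ * ‖v‖ ^ 2 ≤ inner ℝ (A v) v) ∧ ∀ v, inner ℝ (A v) v ≤ p.Lg1 * ‖v‖ ^ 2 := by
  set B : ℝ → Vec dy →L[ℝ] Vec dy := fun s => hessYY g x (y' + s • (y - y')) with hB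
  have hLip : ∀ a b : Vec dy, ‖hessYY g x a - hessYY g x b‖ ≤ |p.Lg2| * ‖a - b‖ := fun a b =>
    (hl.hessYY_lip (pt x a) (pt x b)).trans (mul_le_mul (le_abs_self _)
      (norm_pt_sub_pt_left_le x a b) (norm_nonneg _) (abs_nonneg _))
  have hcont : Continuous (fun a => hessYY g x a) :=
    (LipschitzWith.of_dist_le_mul (K := ⟨|p.Lg2|, abs_nonneg _⟩) fun a b => by
      rw [dist_eq_norm, dist_eq_norm]; exact hLip a b).continuous
  have hBc : Continuous B := hcont.comp (by fun_prop)
  have hBi : IntervalIntegrable B MeasureTheory.volume 0 1 := hBc.intervalIntegrable 0 1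
  have happ : ∀ v, (∫ s in (0 : ℝ)..1, B s) v = ∫ s in (0 : ℝ)..1, B s v := fun v =>
    ContinuousLinearMap.intervalIntegral_apply hBi v
  have hinner : ∀ v w, inner ℝ ((∫ s in (0 : ℝ)..1, B s) v) w
      = ∫ s in (0 : ℝ)..1, inner ℝ (B s v) w := by
    intro v w
    have hc : Continuous fun s => B s v := hBc.clm_apply continuous_const
    have h1 := ((innerSL ℝ w).intervalIntegral_comp_comm
      (hc.intervalIntegrable (μ := MeasureTheory.volume) 0 1)).symm
    rw [happ, real_inner_comm]
    simpa [real_inner_comm] using h1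
  have hIc : ∀ v w, Continuous fun s => inner ℝ (B s v) w := fun v w =>
    (hBc.clm_apply continuous_const).inner continuous_const
  -- Symmetry and both quadratic bounds hold at every `s`, so they pass to the integral.
  refine ⟨∫ s in (0 : ℝ)..1, B s, ?_, fun v w => ?_, fun v => ?_, fun v => ?_⟩
  · rw [happ, intervalIntegral.integral_eq_sub_of_hasDerivAt
      (f := fun s => gradY g x (y' + s • (y - y')))
      (fun s _ => hasDerivAt_gradY_line hs.g_contDiff x y' (y - y') s)
      ((hBc.clm_apply continuous_const).intervalIntegrable 0 1)]
    simp
  · rw [hinner, ← real_inner_comm, hinner]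
    refine intervalIntegral.integral_congr fun s _ => ?_
    simp only [hB]
    rw [inner_hessYY_comm hs.g_contDiff, real_inner_comm]
  · rw [hinner]
    have := intervalIntegral.integral_mono_on (a := 0) (b := 1)
      (f := fun _ => p.μ * ‖v‖ ^ 2) (μ := MeasureTheory.volume) zero_le_one (by simp)
      ((hIc v v).intervalIntegrable 0 1)
      (fun s _ => hs.mul_norm_sq_le_inner_hessYY x (y' + s • (y - y')) v)
    simpa using this
  · rw [hinner]
    have := intervalIntegral.integral_mono_on (a := 0) (b := 1)
      (g := fun _ => p.Lg1 * ‖v‖ ^ 2) (μ := MeasureTheory.volume) zero_le_one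
      ((hIc v v).intervalIntegrable 0 1) (by simp)
      (fun s _ => hl.inner_hessYY_le_Lg1 hs hL x (y' + s • (y - y')) v)
    simpa using this

theorem mul_norm_sq_le_inner_gradY_sub (hs : Smooth f g p) (hl : Lip f g p) (hL : 0 ≤ p.Lg1)
    (x : Vec dx) (y y' : Vec dy) :
    p.μ * ‖y - y'‖ ^ 2 ≤ inner ℝ (gradY g x y - gradY g x y') (y - y') := by
  obtain ⟨A, h1, -, h3, -⟩ := exists_mean_hessYY hs hl hL x y y'
  rw [h1]
  exact h3 _

/-- The mean Hessian reduces this nonlinear statement to the coercivity of one symmetric operator.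
-/
theorem cocoercive_gradY (hs : Smooth f g p) (hl : Lip f g p) (hL : 0 ≤ p.Lg1)
    (x : Vec dx) (y y' : Vec dy) :
    p.μ * p.Lg1 * ‖y - y'‖ ^ 2 + ‖gradY g x y - gradY g x y'‖ ^ 2
      ≤ (p.μ + p.Lg1) * inner ℝ (gradY g x y - gradY g x y') (y - y') := by
  obtain ⟨A, h1, h2, h3, h4⟩ := exists_mean_hessYY hs hl hL x y y'
  rw [h1]
  exact mul_norm_sq_add_norm_sq_apply_le h2 h3 h4 _

theorem quadratic_lower_bound (hs : Smooth f g p) (hl : Lip f g p) (hL : 0 ≤ p.Lg1)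
    (x : Vec dx) (y w : Vec dy) :
    g x y + inner ℝ (gradY g x y) w + p.μ * ‖w‖ ^ 2 / 2 ≤ g x (y + w) := by
  have := add_half_le_of_deriv (fun s => hasDerivAt_line hs.differentiable_g x y w s)
    (a := inner ℝ (gradY g x y) w) (b := p.μ * ‖w‖ ^ 2) (fun s h0 _ => ?_)
  · simpa using this
  · rcases h0.eq_or_lt with h0 | h0
    · simp [← h0]
    have h1 := mul_norm_sq_le_inner_gradY_sub hs hl hL x (y + s • w) y
    rw [add_sub_cancel_left, norm_smul, real_inner_smul_right, inner_sub_left, mul_pow,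
      Real.norm_eq_abs, sq_abs] at h1
    have h2 : s * (p.μ * ‖w‖ ^ 2 * s)
        ≤ s * (inner ℝ (gradY g x (y + s • w)) w - inner ℝ (gradY g x y) w) := by linarith
    linarith [le_of_mul_le_mul_left h2 h0]

theorem Smooth.continuous_g_right (hs : Smooth f g p) (x : Vec dx) : Continuous (g x) :=
  hs.g_contDiff.continuous.comp (contDiff_pt_right (n := 2) x).continuous

/-- Since `yStar` is a choice, a minimizer has to be produced: the quadratic lower bound at `0`
makes `g x` coercive, and a continuous coercive function attains its minimum. -/
theorem isMinOn_yStar (hμ : 0 < p.μ) (hs : Smooth f g p) (hl : Lip f g p) (hL : 0 ≤ p.Lg1)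
    (x : Vec dx) : IsMinOn (g x) Set.univ (yStar g x) := by
  refine Classical.epsilon_spec (p := fun y => IsMinOn (g x) Set.univ y) ?_
  have ht : Filter.Tendsto (g x) (Filter.cocompact (Vec dy)) Filter.atTop := by
    have h1 : Filter.Tendsto (fun r : ℝ => g x 0 + r * (p.μ / 2 * r - ‖gradY g x 0‖))
        Filter.atTop Filter.atTop := by
      refine Filter.tendsto_atTop_add_const_left _ _ (Filter.tendsto_id.atTop_mul_atTop₀ ?_)
      exact Filter.tendsto_atTop_add_const_right _ (-‖gradY g x 0‖)
        (Filter.tendsto_id.const_mul_atTop (by positivity : 0 < p.μ / 2))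
    refine Filter.tendsto_atTop_mono (fun y => ?_)
      (h1.comp (tendsto_norm_cocompact_atTop (E := Vec dy)))
    have h2 := quadratic_lower_bound hs hl hL x 0 y
    have h3 := (abs_le.1 (abs_real_inner_le_norm (gradY g x 0) y)).1
    simp only [zero_add, Function.comp] at h2 ⊢
    nlinarith
  obtain ⟨y, hy⟩ := (hs.continuous_g_right x).exists_forall_le ht
  exact ⟨y, fun z _ => hy z⟩

theorem gradY_yStar (hμ : 0 < p.μ) (hs : Smooth f g p) (hl : Lip f g p) (hL : 0 ≤ p.Lg1)
    (x : Vec dx) : gradY g x (yStar g x) = 0 := by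
  have h := (isMinOn_yStar hμ hs hl hL x).isLocalMin Filter.univ_mem
  have h2 := h.hasFDerivAt_eq_zero (hasGradientAt_gradY hs.differentiable_g x _).hasFDerivAt
  simpa using h2

end LowerLevel

/-! ### The maps `y*` and `v*`, and the hypergradient. -/

section UpperLevel

variable {dx dy : ℕ} {f g : Vec dx → Vec dy → ℝ} {p : Params}

theorem norm_gradY_g_left_sub_le (hs : Smooth f g p) (hl : Lip f g p) (x x' : Vec dx)
    (y : Vec dy) : ‖gradY g x y - gradY g x' y‖ ≤ p.Cgxy * ‖x - x'‖ := by
  refine Convex.norm_image_sub_le_of_norm_fderiv_le (𝕜 := ℝ) (f := fun x => gradY g x y)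
    (s := Set.univ) (fun x _ => (hasFDerivAt_gradY_left hs.g_contDiff x y).differentiableAt)
    (fun x _ => ?_) convex_univ (Set.mem_univ _) (Set.mem_univ _)
  have := hl.hessXY_bound x y
  rwa [hessXY, LinearIsometryEquiv.norm_map] at this

/-- Strong monotonicity at `x` bounds the distance of the two solutions by `‖∇_y g(x, y*(x'))‖ / μ`,
and this gradient is zero at `x'`, so it is at most `Cgxy ‖x - x'‖`. No implicit function theorem is
involved. -/
theorem norm_yStar_sub_le (hμ : 0 < p.μ) (hs : Smooth f g p) (hl : Lip f g p) (hL : 0 ≤ p.Lg1)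
    (x x' : Vec dx) : ‖yStar g x - yStar g x'‖ ≤ p.Ly * ‖x - x'‖ := by
  have h1 := mul_norm_le_of_inner
    (mul_norm_sq_le_inner_gradY_sub hs hl hL x (yStar g x) (yStar g x'))
  have h2 := norm_gradY_g_left_sub_le hs hl x' x (yStar g x')
  rw [gradY_yStar hμ hs hl hL] at h1 h2
  rw [zero_sub, norm_neg] at h1 h2
  rw [norm_sub_rev x'] at h2
  rw [Params.Ly, div_mul_eq_mul_div, le_div_iff₀ hμ]
  linarith

theorem mul_norm_le_norm_hessYY (hs : Smooth f g p) (x : Vec dx) (y w : Vec dy) :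
    p.μ * ‖w‖ ≤ ‖hessYY g x y w‖ :=
  mul_norm_le_of_inner (hs.mul_norm_sq_le_inner_hessYY x y w)

/-- The solution `v*(x)` of the linear system `∇_y∇_y g(x, y*(x)) v = ∇_y f(x, y*(x))`. -/
noncomputable def vStar (f g : Vec dx → Vec dy → ℝ) (x : Vec dx) : Vec dy :=
  Classical.epsilon fun v => hessYY g x (yStar g x) v = gradY f x (yStar g x)

theorem hessYY_vStar (hμ : 0 < p.μ) (hs : Smooth f g p) (x : Vec dx) :
    hessYY g x (yStar g x) (vStar f g x) = gradY f x (yStar g x) := by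
  refine Classical.epsilon_spec (p := fun v => hessYY g x (yStar g x) v = gradY f x (yStar g x)) ?_
  have hinj : Function.Injective (hessYY g x (yStar g x) : Vec dy →ₗ[ℝ] Vec dy) := by
    rw [← LinearMap.ker_eq_bot, LinearMap.ker_eq_bot']
    intro w hw
    have h1 := mul_norm_le_norm_hessYY hs x (yStar g x) w
    have h2 : hessYY g x (yStar g x) w = 0 := hw
    rw [h2, norm_zero] at h1
    exact norm_le_zero_iff.1 (nonpos_of_mul_nonpos_right h1 hμ)
  exact LinearMap.injective_iff_surjective.1 hinj _

theorem norm_vStar_le (hμ : 0 < p.μ) (hs : Smooth f g p) (hl : Lip f g p) (x : Vec dx) :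
    ‖vStar f g x‖ ≤ p.Cfy / p.μ := by
  have h1 := mul_norm_le_norm_hessYY hs x (yStar g x) (vStar f g x)
  rw [hessYY_vStar hμ hs] at h1
  rw [le_div_iff₀ hμ]
  linarith [hl.gradY_bound x (yStar g x)]

theorem gradR_eq (hs : Smooth f g p) (x : Vec dx) (y v : Vec dy) :
    gradR f g x y v = hessYY g x y v - gradY f x y := by
  have h1 : HasFDerivAt (fun v => linSys f g x y v)
      ((1 / 2 : ℝ) • ((fderivInnerCLM ℝ (v, hessYY g x y v)).comp
        ((ContinuousLinearMap.id ℝ (Vec dy)).prod (hessYY g x y)))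
      - (fderivInnerCLM ℝ (v, gradY f x y)).comp
        ((ContinuousLinearMap.id ℝ (Vec dy)).prod 0)) v :=
    ((((hasFDerivAt_id v).inner ℝ (hessYY g x y).hasFDerivAt).const_mul (1 / 2)).sub
      ((hasFDerivAt_id v).inner ℝ (hasFDerivAt_const _ v)))
  have h2 : HasGradientAt (fun v => linSys f g x y v) (hessYY g x y v - gradY f x y) v := by
    rw [hasGradientAt_iff_hasFDerivAt]
    refine h1.congr_fderiv ?_
    ext1 w
    have h3 := inner_hessYY_comm hs.g_contDiff x y v w
    have h4 := real_inner_comm w (hessYY g x y v)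
    have h5 := real_inner_comm w (gradY f x y)
    simp [fderivInnerCLM_apply]
    linarith
  exact h2.gradient

/-- The right-hand side and the matrix of the linear system move with `y` at rate `M`. -/
theorem norm_gradR_vStar_le (hμ : 0 < p.μ) (hs : Smooth f g p) (hl : Lip f g p) (hdy : 0 < dy)
    (x : Vec dx) (y : Vec dy) :
    ‖gradR f g x y (vStar f g x)‖ ≤ p.M * ‖y - yStar g x‖ := by
  have e : gradR f g x y (vStar f g x)
      = (hessYY g x y - hessYY g x (yStar g x)) (vStar f g x)
        - (gradY f x y - gradY f x (yStar g x)) := by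
    rw [gradR_eq hs, sub_apply, hessYY_vStar hμ hs]
    abel
  have h1 : ‖(hessYY g x y - hessYY g x (yStar g x)) (vStar f g x)‖
      ≤ (p.Lg2 * ‖y - yStar g x‖) * (p.Cfy / p.μ) := by
    refine ((hessYY g x y - hessYY g x (yStar g x)).le_of_opNorm_le_of_le
      ((hl.hessYY_lip (pt x y) (pt x (yStar g x))).trans ?_) (norm_vStar_le hμ hs hl x))
    exact mul_le_mul_of_nonneg_left (norm_pt_sub_pt_left_le _ _ _) (hl.Lg2_nonneg hdy)
  have h2 : ‖gradY f x y - gradY f x (yStar g x)‖ ≤ p.Lf1 * ‖y - yStar g x‖ :=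
    (norm_gradY_sub_le hs.differentiable_f hl.gradf_lip x x y _).trans
      (mul_le_mul_of_nonneg_left (norm_pt_sub_pt_left_le _ _ _) (hl.Lf1_nonneg hdy))
  rw [e]
  refine (norm_sub_le _ _).trans ((add_le_add h1 h2).trans_eq ?_)
  rw [Params.M]; ring

theorem gradR_sub (hs : Smooth f g p) (x : Vec dx) (y v w : Vec dy) :
    gradR f g x y v = hessYY g x y (v - w) + gradR f g x y w := by
  rw [gradR_eq hs, gradR_eq hs, map_sub]; abel

theorem norm_pt_yStar_sub_le (hμ : 0 < p.μ) (hs : Smooth f g p) (hl : Lip f g p) (hL : 0 ≤ p.Lg1)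
    (x x' : Vec dx) :
    ‖pt x (yStar g x) - pt x' (yStar g x')‖ ≤ (1 + p.Ly) * ‖x - x'‖ := by
  have := norm_yStar_sub_le hμ hs hl hL x x'
  linarith [norm_pt_sub_pt_le x x' (yStar g x) (yStar g x')]

/-- Applying the Hessian at `x` to the difference leaves the change of the right-hand side and the
change of the matrix acting on `v*(x')`; strong convexity inverts the Hessian at cost `1 / μ`. -/
theorem norm_vStar_sub_le (hμ : 0 < p.μ) (hs : Smooth f g p) (hl : Lip f g p) (hdy : 0 < dy)
    (x x' : Vec dx) : ‖vStar f g x - vStar f g x'‖ ≤ p.Lv * ‖x - x'‖ := by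
  have hpt := norm_pt_yStar_sub_le hμ hs hl (hl.Lg1_nonneg hdy) x x'
  have h1 := mul_norm_le_norm_hessYY hs x (yStar g x) (vStar f g x - vStar f g x')
  have e : hessYY g x (yStar g x) (vStar f g x - vStar f g x')
      = (gradY f x (yStar g x) - gradY f x' (yStar g x'))
        - (hessYY g x (yStar g x) - hessYY g x' (yStar g x')) (vStar f g x') := by
    rw [map_sub, sub_apply, hessYY_vStar hμ hs, hessYY_vStar hμ hs]
    abel
  have h2 : ‖gradY f x (yStar g x) - gradY f x' (yStar g x')‖
      ≤ p.Lf1 * ((1 + p.Ly) * ‖x - x'‖) :=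
    (norm_gradY_sub_le hs.differentiable_f hl.gradf_lip x x' _ _).trans
      (mul_le_mul_of_nonneg_left hpt (hl.Lf1_nonneg hdy))
  have h3 : ‖(hessYY g x (yStar g x) - hessYY g x' (yStar g x')) (vStar f g x')‖
      ≤ (p.Lg2 * ((1 + p.Ly) * ‖x - x'‖)) * (p.Cfy / p.μ) :=
    (hessYY g x (yStar g x) - hessYY g x' (yStar g x')).le_of_opNorm_le_of_le
      ((hl.hessYY_lip (pt x (yStar g x)) (pt x' (yStar g x'))).trans
        (mul_le_mul_of_nonneg_left hpt (hl.Lg2_nonneg hdy))) (norm_vStar_le hμ hs hl x')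
  have h4 : p.μ * ‖vStar f g x - vStar f g x'‖ ≤ p.μ * (p.Lv * ‖x - x'‖) := by
    rw [e] at h1
    refine h1.trans ((norm_sub_le _ _).trans ((add_le_add h2 h3).trans_eq ?_))
    rw [Params.Lv]; field_simp
  exact le_of_mul_le_mul_left h4 hμ

/-- The hypergradient `∇Φ(x)`. -/
noncomputable def gradPhi (f g : Vec dx → Vec dy → ℝ) (x : Vec dx) : Vec dx :=
  hyperGrad f g x (yStar g x) (vStar f g x)

/-- Differentiability of `y*` is not needed. The multiplier `v*` removes the `y`-derivative, and
Lipschitz continuity of `y*` turns a remainder that is small relative to the movement on the graph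
into one small relative to `x' - x`. -/
theorem hasGradientAt_Phi (hμ : 0 < p.μ) (hs : Smooth f g p) (hl : Lip f g p) (hL : 0 ≤ p.Lg1)
    (x : Vec dx) : HasGradientAt (Phi f g) (gradPhi f g x) x := by
  -- `Φ` is `Ψ = f - ⟪v*(x), ∇_y g⟫` along the graph of `y*`, and `∂_y Ψ` vanishes at `(x, y*(x))`
  set Ψ : WithLp 2 (Vec dx × Vec dy) → ℝ := fun z =>
    joint f z - inner ℝ (vStar f g x) (gradY g z.fst z.snd) with hΨ
  have hd : HasFDerivAt Ψ (fderiv ℝ (joint f) (pt x (yStar g x))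
      - (innerSL ℝ (vStar f g x)).comp (fderiv ℝ
        (fun z : WithLp 2 (Vec dx × Vec dy) => gradY g z.fst z.snd) (pt x (yStar g x))))
      (pt x (yStar g x)) :=
    (hs.differentiable_f (pt x (yStar g x))).hasFDerivAt.sub
      ((innerSL ℝ (vStar f g x)).hasFDerivAt.comp _
        (differentiable_gradY hs.g_contDiff (pt x (yStar g x))).hasFDerivAt)
  have hD : ∀ z : WithLp 2 (Vec dx × Vec dy), (fderiv ℝ (joint f) (pt x (yStar g x))
      - (innerSL ℝ (vStar f g x)).comp (fderiv ℝ
        (fun z : WithLp 2 (Vec dx × Vec dy) => gradY g z.fst z.snd) (pt x (yStar g x)))) z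
      = inner ℝ (gradPhi f g x) z.fst := by
    intro z
    rw [sub_apply, fderiv_joint_apply hs.differentiable_f,
      ContinuousLinearMap.comp_apply, fderiv_gradY_apply hs.g_contDiff, innerSL_apply_apply,
      inner_add_right, ContinuousLinearMap.adjoint_inner_right,
      ← inner_hessYY_comm hs.g_contDiff, hessYY_vStar hμ hs, gradPhi, hyperGrad, inner_sub_left]
    ring
  have hval : ∀ x', Ψ (pt x' (yStar g x')) = Phi f g x' := by
    intro x'
    have h0 : gradY g (pt x' (yStar g x')).fst (pt x' (yStar g x')).snd = 0 :=
      gradY_yStar hμ hs hl hL x'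
    simp only [hΨ]
    rw [h0, inner_zero_right, sub_zero]
    rfl
  have hO : (fun x' => pt x' (yStar g x') - pt x (yStar g x)) =O[nhds x] fun x' => x' - x :=
    Asymptotics.IsBigO.of_bound _
      (Filter.Eventually.of_forall fun x' => norm_pt_yStar_sub_le hμ hs hl hL x' x)
  have hc : Filter.Tendsto (fun x' => pt x' (yStar g x')) (nhds x)
      (nhds (pt x (yStar g x))) := by
    rw [tendsto_iff_norm_sub_tendsto_zero]
    refine squeeze_zero (fun _ => norm_nonneg _)
      (fun x' => norm_pt_yStar_sub_le hμ hs hl hL x' x) ?_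
    have : Filter.Tendsto (fun x' => (1 + p.Ly) * ‖x' - x‖) (nhds x)
        (nhds ((1 + p.Ly) * ‖x - x‖)) :=
      (Continuous.tendsto (by fun_prop) x)
    simpa using this
  rw [hasGradientAt_iff_hasFDerivAt, hasFDerivAt_iff_isLittleO]
  have h := ((hasFDerivAt_iff_isLittleO.1 hd).comp_tendsto hc).trans_isBigO hO
  refine h.congr_left fun x' => ?_
  simp only [Function.comp]
  rw [hval, hval, hD]
  rfl

theorem norm_gradPhi_sub_le (hμ : 0 < p.μ) (hs : Smooth f g p) (hl : Lip f g p) (hdy : 0 < dy)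
    (x x' : Vec dx) : ‖gradPhi f g x - gradPhi f g x'‖ ≤ p.LΦ * ‖x - x'‖ := by
  have hpt := norm_pt_yStar_sub_le hμ hs hl (hl.Lg1_nonneg hdy) x x'
  have e : gradPhi f g x - gradPhi f g x'
      = (gradX f x (yStar g x) - gradX f x' (yStar g x'))
        - (hessXY g x (yStar g x) - hessXY g x' (yStar g x')) (vStar f g x)
        - hessXY g x' (yStar g x') (vStar f g x - vStar f g x') := by
    rw [gradPhi, gradPhi, hyperGrad, hyperGrad, map_sub, sub_apply]
    abel
  have h1 : ‖gradX f x (yStar g x) - gradX f x' (yStar g x')‖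
      ≤ p.Lf1 * ((1 + p.Ly) * ‖x - x'‖) :=
    (norm_gradX_sub_le hs.differentiable_f hl.gradf_lip x x' _ _).trans
      (mul_le_mul_of_nonneg_left hpt (hl.Lf1_nonneg hdy))
  have h2 : ‖(hessXY g x (yStar g x) - hessXY g x' (yStar g x')) (vStar f g x)‖
      ≤ (p.Lg2 * ((1 + p.Ly) * ‖x - x'‖)) * (p.Cfy / p.μ) :=
    (hessXY g x (yStar g x) - hessXY g x' (yStar g x')).le_of_opNorm_le_of_le
      ((hl.hessXY_lip (pt x (yStar g x)) (pt x' (yStar g x'))).trans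
        (mul_le_mul_of_nonneg_left hpt (hl.Lg2_nonneg hdy))) (norm_vStar_le hμ hs hl x)
  have h3 : ‖hessXY g x' (yStar g x') (vStar f g x - vStar f g x')‖
      ≤ p.Cgxy * (p.Lv * ‖x - x'‖) :=
    (hessXY g x' (yStar g x')).le_of_opNorm_le_of_le (hl.hessXY_bound _ _)
      (norm_vStar_sub_le hμ hs hl hdy x x')
  rw [e]
  refine (norm_sub_le _ _).trans ((add_le_add ((norm_sub_le _ _).trans (add_le_add h1 h2))
    h3).trans_eq ?_)
  -- The first two terms sum to `M (1 + Ly)` and `Cgxy * Lv` is `M Ly (1 + Ly)`; hence the square in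
  -- `LΦ`.
  rw [Params.LΦ, Params.Lv, Params.Ly]
  field_simp

theorem Phi_descent (hμ : 0 < p.μ) (hs : Smooth f g p) (hl : Lip f g p) (hdy : 0 < dy)
    (x w : Vec dx) :
    Phi f g (x + w) ≤ Phi f g x + inner ℝ (gradPhi f g x) w + p.LΦ * ‖w‖ ^ 2 / 2 := by
  have hd : ∀ s : ℝ, HasDerivAt (fun s : ℝ => Phi f g (x + s • w))
      (inner ℝ (gradPhi f g (x + s • w)) w) s := by
    intro s
    have h1 : HasDerivAt (fun s : ℝ => x + s • w) w s := by
      simpa using ((hasDerivAt_id s).smul_const w).const_add x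
    have h2 := (hasGradientAt_Phi hμ hs hl (hl.Lg1_nonneg hdy)
      (x + s • w)).hasFDerivAt.comp_hasDerivAt s h1
    rw [InnerProductSpace.toDual_apply_apply] at h2
    exact h2
  have := le_add_half_of_deriv hd (a := inner ℝ (gradPhi f g x) w) (b := p.LΦ * ‖w‖ ^ 2)
    (fun s h0 _ => ?_)
  · simpa using this
  · have h1 := real_inner_le_norm (gradPhi f g (x + s • w) - gradPhi f g x) w
    have h2 := norm_gradPhi_sub_le hμ hs hl hdy (x + s • w) x
    rw [add_sub_cancel_left, norm_smul, Real.norm_of_nonneg h0] at h2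
    rw [inner_sub_left] at h1
    have h3 := mul_le_mul_of_nonneg_right h2 (norm_nonneg w)
    linarith

theorem norm_gradPhi_sub_hyperGrad_sq_le (hμ : 0 < p.μ) (hs : Smooth f g p) (hl : Lip f g p)
    (hdy : 0 < dy) (x : Vec dx) (y v : Vec dy) :
    ‖gradPhi f g x - hyperGrad f g x y v‖ ^ 2
      ≤ p.Lbar ^ 2 * (‖y - yStar g x‖ ^ 2 + ‖v - vStar f g x‖ ^ 2) := by
  have e : gradPhi f g x - hyperGrad f g x y v
      = (gradX f x (yStar g x) - gradX f x y)
        - (hessXY g x (yStar g x) - hessXY g x y) (vStar f g x)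
        + hessXY g x y (v - vStar f g x) := by
    rw [gradPhi, hyperGrad, hyperGrad, map_sub, sub_apply]
    abel
  have hpt : ‖pt x (yStar g x) - pt x y‖ ≤ ‖y - yStar g x‖ := by
    rw [norm_sub_rev y]
    exact norm_pt_sub_pt_left_le _ _ _
  have h1 : ‖gradX f x (yStar g x) - gradX f x y‖ ≤ p.Lf1 * ‖y - yStar g x‖ :=
    (norm_gradX_sub_le hs.differentiable_f hl.gradf_lip x x _ _).trans
      (mul_le_mul_of_nonneg_left hpt (hl.Lf1_nonneg hdy))
  have h2 : ‖(hessXY g x (yStar g x) - hessXY g x y) (vStar f g x)‖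
      ≤ (p.Lg2 * ‖y - yStar g x‖) * (p.Cfy / p.μ) :=
    (hessXY g x (yStar g x) - hessXY g x y).le_of_opNorm_le_of_le
      ((hl.hessXY_lip (pt x (yStar g x)) (pt x y)).trans
        (mul_le_mul_of_nonneg_left hpt (hl.Lg2_nonneg hdy))) (norm_vStar_le hμ hs hl x)
  have h3 : ‖hessXY g x y (v - vStar f g x)‖ ≤ p.Cgxy * ‖v - vStar f g x‖ :=
    (hessXY g x y).le_of_opNorm_le (hl.hessXY_bound _ _) _
  rw [e]
  have h4 := (norm_add_le _ _).trans (add_le_add ((norm_sub_le _ _).trans (add_le_add h1 h2)) h3)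
  -- The inequality `(a + b)² ≤ 2a² + 2b²` is used once to separate `y` from `v` and once more
  -- inside the `y`-part; these are the factors 4 and 2 in the two entries of `Lbar`.
  have hb1 : 4 * (p.Cfy ^ 2 * p.Lg2 ^ 2 / p.μ ^ 2 + p.Lf1 ^ 2) ≤ p.Lbar ^ 2 := by
    have h5 : 2 * Real.sqrt (p.Cfy ^ 2 * p.Lg2 ^ 2 / p.μ ^ 2 + p.Lf1 ^ 2) ≤ p.Lbar :=
      le_max_left _ _
    have h6 := pow_le_pow_left₀ (by positivity) h5 2
    rw [mul_pow, Real.sq_sqrt (by positivity)] at h6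
    linarith
  have hb2 : 2 * p.Cgxy ^ 2 ≤ p.Lbar ^ 2 := by
    have h5 : Real.sqrt 2 * p.Cgxy ≤ p.Lbar := le_max_right _ _
    have h6 := pow_le_pow_left₀ (mul_nonneg (by positivity) hl.Cgxy_nonneg) h5 2
    rw [mul_pow, Real.sq_sqrt (by positivity)] at h6
    linarith
  set E := ‖y - yStar g x‖
  set U := ‖v - vStar f g x‖
  refine (pow_le_pow_left₀ (norm_nonneg _) h4 2).trans ?_
  set q := p.Cfy / p.μ
  have hq : p.Cfy ^ 2 * p.Lg2 ^ 2 / p.μ ^ 2 = (p.Lg2 * q) ^ 2 := by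
    simp only [q]; field_simp
  rw [hq] at hb1
  have h7 := mul_le_mul_of_nonneg_right hb1 (sq_nonneg E)
  have h8 := mul_le_mul_of_nonneg_right hb2 (sq_nonneg U)
  have h9 := sq_nonneg (p.Lf1 * E - p.Lg2 * q * E)
  have h10 := sq_nonneg (p.Lf1 * E + p.Lg2 * q * E - p.Cgxy * U)
  nlinarith

end UpperLevel

/-! ### One-step inequalities for gradient steps towards a moving root. -/

section VectorSteps

variable {E : Type*} [NormedAddCommGroup E] [InnerProductSpace ℝ E]

theorem norm_add_sq_le_young (a b : E) {c : ℝ} (hc : 0 < c) :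
    ‖a + b‖ ^ 2 ≤ (1 + c) * ‖a‖ ^ 2 + (1 + 1 / c) * ‖b‖ ^ 2 := by
  have h1 := real_inner_le_norm a b
  have h2 : 2 * (‖a‖ * ‖b‖) ≤ c * ‖a‖ ^ 2 + 1 / c * ‖b‖ ^ 2 := by
    have h3 : c * ‖a‖ ^ 2 + 1 / c * ‖b‖ ^ 2 - 2 * (‖a‖ * ‖b‖)
        = 1 / c * (c * ‖a‖ - ‖b‖) ^ 2 := by field_simp; ring
    have h4 : 0 ≤ 1 / c * (c * ‖a‖ - ‖b‖) ^ 2 := by positivity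
    linarith
  rw [norm_add_sq_real]
  linarith

/-- One gradient step with step size `1 / β`, followed by a shift `w` of the root. -/
theorem norm_gradient_step_sq_le {e G w : E} {m K β : ℝ} (hm : 0 < m) (hK : 0 < K)
    (hβ : m + K ≤ β)
    (h : m * K * ‖e‖ ^ 2 + ‖G‖ ^ 2 ≤ (m + K) * inner ℝ G e) :
    ‖e - (1 / β) • G + w‖ ^ 2 + ‖G‖ ^ 2 / (β * (m + K))
      ≤ ‖e‖ ^ 2 + β * (m + K) / (m * K) * ‖w‖ ^ 2 := by
  have hmK : 0 < m + K := by positivity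
  have hβ0 : 0 < β := by linarith
  -- The contraction rate doubles as the Young parameter: `(1 + ρ)(1 - ρ) ≤ 1`, and the shift costs
  -- `1 + 1/ρ ≤ 2/ρ = β (m + K) / (m K)`.
  set ρ := 2 * (1 / β) * (m * K) / (m + K) with hρ
  have hρ0 : 0 < ρ := by positivity
  have hρ1 : ρ ≤ 1 := by
    have : ρ = 2 * (m * K) / (β * (m + K)) := by rw [hρ]; field_simp
    rw [this, div_le_one (by positivity)]
    nlinarith [sq_nonneg (m - K), mul_le_mul_of_nonneg_right hβ hmK.le]
  have h1 := norm_sub_smul_sq_le hmK (by positivity : 0 ≤ 1 / β) h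
  have h2 := norm_add_sq_le_young (e - (1 / β) • G) w hρ0
  have h3 : 1 / β * (1 / β - 2 / (m + K)) * ‖G‖ ^ 2 ≤ - (‖G‖ ^ 2 / (β * (m + K))) := by
    have h4 : 1 / β ≤ 1 / (m + K) := one_div_le_one_div_of_le hmK hβ
    have h5 : - (‖G‖ ^ 2 / (β * (m + K))) = 1 / β * (1 / (m + K) - 2 / (m + K)) * ‖G‖ ^ 2 := by
      field_simp; ring
    rw [h5]
    gcongr
  have h6 : (1 + ρ) * ‖e - (1 / β) • G‖ ^ 2
      ≤ (1 + ρ) * ((1 - ρ) * ‖e‖ ^ 2 - ‖G‖ ^ 2 / (β * (m + K))) := by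
    gcongr; linarith
  have h7 : (1 + 1 / ρ) * ‖w‖ ^ 2 ≤ β * (m + K) / (m * K) * ‖w‖ ^ 2 := by
    gcongr
    have h8 : β * (m + K) / (m * K) = 1 / ρ + 1 / ρ := by rw [hρ]; field_simp; ring
    rw [h8]
    have : 1 ≤ 1 / ρ := by rw [le_div_iff₀ hρ0]; linarith
    linarith
  have h9 : 0 ≤ ‖G‖ ^ 2 / (β * (m + K)) := by positivity
  nlinarith [mul_nonneg hρ0.le h9, mul_nonneg (sq_nonneg ρ) (sq_nonneg ‖e‖)]

/-- One gradient step never leaves the ball of radius `C / m` as long as the step size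
normalizes the gradient. -/
theorem norm_normalized_step_le {e G : E} {m K β C : ℝ} (hm : 0 < m) (hmK : m ≤ K) (hβ : 0 < β)
    (hC : m + K ≤ C) (hβC : β ≤ C) (hG : ‖G‖ ≤ β) (he : m * ‖e‖ ≤ ‖G‖)
    (h : m * K * ‖e‖ ^ 2 + ‖G‖ ^ 2 ≤ (m + K) * inner ℝ G e) :
    ‖e - (1 / β) • G‖ ≤ C / m := by
  have hmK' : 0 < m + K := by linarith
  have he' : ‖e‖ ≤ β / m := by rw [le_div_iff₀ hm]; linarith
  -- A step size up to `2 / (m + K)` does not increase the distance. A larger one forces `β ≤ C /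
  -- 2`; then the distance is at most `C / (2m)`, and the normalized step adds at most `1 ≤ C /
  -- (2m)`.
  rcases le_total (1 / β) (2 / (m + K)) with h1 | h1
  · have h2 := norm_sub_smul_sq_le hmK' (by positivity : 0 ≤ 1 / β) h
    have h3 : 1 / β * (1 / β - 2 / (m + K)) * ‖G‖ ^ 2 ≤ 0 :=
      mul_nonpos_of_nonpos_of_nonneg
        (mul_nonpos_of_nonneg_of_nonpos (by positivity) (by linarith)) (by positivity)
    have h4 : 0 ≤ 2 * (1 / β) * (m * K) / (m + K) := by
      have : 0 < K := by linarith
      positivity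
    have h5 : ‖e - (1 / β) • G‖ ^ 2 ≤ ‖e‖ ^ 2 := by
      nlinarith [mul_nonneg h4 (sq_nonneg ‖e‖)]
    have h6 : ‖e - (1 / β) • G‖ ≤ ‖e‖ :=
      (pow_le_pow_iff_left₀ (norm_nonneg _) (norm_nonneg _) two_ne_zero).1 h5
    refine h6.trans (he'.trans ?_)
    gcongr
  · have h2 : β ≤ C / 2 := by
      rw [div_le_div_iff₀ hmK' hβ] at h1
      linarith
    have h3 : ‖(1 / β) • G‖ ≤ 1 := by
      rw [norm_smul, Real.norm_of_nonneg (by positivity), one_div, inv_mul_le_one₀ hβ]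
      exact hG
    have h4 : (1 : ℝ) ≤ C / 2 / m := by rw [le_div_iff₀ hm]; linarith
    have h5 : ‖e‖ ≤ C / 2 / m := he'.trans (by gcongr)
    calc ‖e - (1 / β) • G‖ ≤ ‖e‖ + ‖(1 / β) • G‖ := norm_sub_le _ _
      _ ≤ C / 2 / m + C / 2 / m := by linarith
      _ = C / m := by ring

/-- One inexact gradient step on a quadratic, with gradient `q + δ` instead of `q`, followed by a
shift `w` of the root. -/
theorem norm_inexact_step_sq_le {u q δ w : E} {m K φ : ℝ} (hm : 0 < m) (hK : 0 < K)
    (hφ : 2 * (m + K) ≤ φ) (h : m * K * ‖u‖ ^ 2 + ‖q‖ ^ 2 ≤ (m + K) * inner ℝ q u) :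
    ‖q + δ‖ ^ 2 / φ ≤ 2 * (m + K) * (‖u‖ ^ 2 - ‖u - (1 / φ) • (q + δ) + w‖ ^ 2)
      + (4 * (m + K) ^ 2 / (m * K) + 8) * ‖δ‖ ^ 2 / φ
      + 4 * (m + K) ^ 2 / (m * K) * φ * ‖w‖ ^ 2 := by
  have hmK : 0 < m + K := by positivity
  have hφ0 : 0 < φ := by linarith
  set ρ := 2 * (1 / φ) * (m * K) / (m + K) with hρ
  have hρ0 : 0 < ρ := by positivity
  have hρ1 : ρ ≤ 1 / 4 := by
    have : ρ = 2 * (m * K) / (φ * (m + K)) := by rw [hρ]; field_simp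
    rw [this, div_le_iff₀ (by positivity)]
    nlinarith [sq_nonneg (m - K), mul_le_mul_of_nonneg_right hφ hmK.le]
  -- Young's inequality is used twice with parameter `ρ / 3`, for `δ` and for `w`: then `(1 + ρ/3)²
  -- (1 - ρ) ≤ 1`, while both errors cost at most `4 / ρ`.
  have hc : 0 < ρ / 3 := by positivity
  have h1 := norm_sub_smul_sq_le hmK (by positivity : 0 ≤ 1 / φ) h
  have h2 := norm_add_sq_le_young (u - (1 / φ) • q) (-((1 / φ) • δ)) hc
  have h3 := norm_add_sq_le_young (u - (1 / φ) • q + -((1 / φ) • δ)) w hc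
  have e : u - (1 / φ) • q + -((1 / φ) • δ) + w = u - (1 / φ) • (q + δ) + w := by
    rw [smul_add]; abel
  rw [e] at h3
  rw [norm_neg, norm_smul, mul_pow, Real.norm_eq_abs, sq_abs] at h2
  have h4 : 1 / φ * (1 / φ - 2 / (m + K)) * ‖q‖ ^ 2
      ≤ - (3 / 2 * ((1 / φ) * ‖q‖ ^ 2 / (m + K))) := by
    have h4 : 1 / φ ≤ 1 / (2 * (m + K)) := one_div_le_one_div_of_le (by positivity) hφ
    have h5 : - (3 / 2 * ((1 / φ) * ‖q‖ ^ 2 / (m + K)))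
        = 1 / φ * (1 / (2 * (m + K)) - 2 / (m + K)) * ‖q‖ ^ 2 := by
      field_simp; ring
    rw [h5]
    gcongr
  set Q := (1 / φ) * ‖q‖ ^ 2 / (m + K) with hQ
  set D := (1 / φ) ^ 2 * ‖δ‖ ^ 2 with hD
  have hQ0 : 0 ≤ Q := by positivity
  have hD0 : 0 ≤ D := by positivity
  have hone : 1 + 1 / (ρ / 3) ≤ 4 / ρ := by
    have h5 : 4 / ρ = 1 / ρ + 1 / (ρ / 3) := by field_simp; norm_num
    have h6 : 1 ≤ 1 / ρ := by rw [le_div_iff₀ hρ0]; linarith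
    linarith
  have htwo : (1 + ρ / 3) * (1 + 1 / (ρ / 3)) ≤ 4 / ρ := by
    have h5 : (1 + ρ / 3) * (1 + 1 / (ρ / 3)) = (3 + 2 * ρ + ρ ^ 2 / 3) / ρ := by
      field_simp; ring
    rw [h5]
    gcongr
    nlinarith
  have hthree : (1 + ρ / 3) * ((1 + ρ / 3) * (1 - ρ)) ≤ 1 := by
    nlinarith [pow_pos hρ0 2, pow_pos hρ0 3]
  have hfour : 1 ≤ (1 + ρ / 3) * (1 + ρ / 3) := by nlinarith
  have h6 : ‖u - (1 / φ) • (q + δ) + w‖ ^ 2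
      ≤ ‖u‖ ^ 2 - 3 / 2 * Q + 4 / ρ * D + 4 / ρ * ‖w‖ ^ 2 := by
    have h7 : ‖u - (1 / φ) • q‖ ^ 2 ≤ (1 - ρ) * ‖u‖ ^ 2 - 3 / 2 * Q := by linarith
    calc ‖u - (1 / φ) • (q + δ) + w‖ ^ 2
        ≤ (1 + ρ / 3) * ((1 + ρ / 3) * ((1 - ρ) * ‖u‖ ^ 2 - 3 / 2 * Q)
          + (1 + 1 / (ρ / 3)) * D) + (1 + 1 / (ρ / 3)) * ‖w‖ ^ 2 := by
          refine h3.trans ?_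
          gcongr
          refine h2.trans ?_
          gcongr
      _ = (1 + ρ / 3) * ((1 + ρ / 3) * (1 - ρ)) * ‖u‖ ^ 2
          - (1 + ρ / 3) * (1 + ρ / 3) * (3 / 2 * Q)
          + (1 + ρ / 3) * (1 + 1 / (ρ / 3)) * D + (1 + 1 / (ρ / 3)) * ‖w‖ ^ 2 := by ring
      _ ≤ 1 * ‖u‖ ^ 2 - 1 * (3 / 2 * Q) + 4 / ρ * D + 4 / ρ * ‖w‖ ^ 2 := by gcongr
      _ = _ := by ring
  -- The Young parameter `2` produces exactly the multiple `3 ‖q‖²` that the step saves in `h9`.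
  have h7 : ‖q + δ‖ ^ 2 ≤ 3 * ‖q‖ ^ 2 + 3 / 2 * ‖δ‖ ^ 2 := by
    have := norm_add_sq_le_young q δ (c := 2) (by norm_num)
    linarith
  have h8 := mul_le_mul_of_nonneg_left h6 (by positivity : 0 ≤ 2 * (m + K))
  have h9 : 2 * (m + K) * (‖u‖ ^ 2 - 3 / 2 * Q + 4 / ρ * D + 4 / ρ * ‖w‖ ^ 2)
      = 2 * (m + K) * ‖u‖ ^ 2 - 3 * ‖q‖ ^ 2 / φ
        + 4 * (m + K) ^ 2 / (m * K) * (‖δ‖ ^ 2 / φ)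
        + 4 * (m + K) ^ 2 / (m * K) * φ * ‖w‖ ^ 2 := by
    rw [hQ, hD, hρ]; field_simp
  have h10 : ‖q + δ‖ ^ 2 / φ ≤ 3 * ‖q‖ ^ 2 / φ + 3 / 2 * (‖δ‖ ^ 2 / φ) := by
    rw [← mul_div_assoc, ← add_div]
    gcongr
  have h11 : 0 ≤ ‖δ‖ ^ 2 / φ := by positivity
  have h12 : (4 * (m + K) ^ 2 / (m * K) + 8) * ‖δ‖ ^ 2 / φ
      = 4 * (m + K) ^ 2 / (m * K) * (‖δ‖ ^ 2 / φ) + 8 * (‖δ‖ ^ 2 / φ) := by ring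
  rw [h12]
  linarith

end VectorSteps

/-! ### Reduction to scalar sequences. -/

/-- The sign conditions on the problem parameters. -/
structure Params.Valid (p : Params) : Prop where
  μ_pos : 0 < p.μ
  μ_le_Lg1 : p.μ ≤ p.Lg1
  μ_le_Cgyy : p.μ ≤ p.Cgyy
  Lf1_nonneg : 0 ≤ p.Lf1
  Lg2_nonneg : 0 ≤ p.Lg2
  Cfx_nonneg : 0 ≤ p.Cfx
  Cfy_nonneg : 0 ≤ p.Cfy
  Cgxy_nonneg : 0 ≤ p.Cgxy
  one_le_α0 : 1 ≤ p.α0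
  β0_pos : 0 < p.β0
  γ0_pos : 0 < p.γ0

/-- The scalar relations between the accumulators, the norms `G`, `r`, `h` of the three
directions, the distances `e`, `u` of `y`, `v` to `y*`, `v*`, and the values `F` of `Φ`. -/
structure Trajectory (p : Params) (α β γ φ G r h e u F : ℕ → ℝ) : Prop where
  α_zero : α 0 = p.α0
  β_zero : β 0 = p.β0
  γ_zero : γ 0 = p.γ0
  G_zero : G 0 = p.G0
  r_zero : r 0 = p.R0
  φ_eq : ∀ k, φ k = max (β k) (γ k)
  α_pos : ∀ k, 0 < α k
  β_pos : ∀ k, 0 < β k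
  γ_pos : ∀ k, 0 < γ k
  G_nonneg : ∀ k, 0 ≤ G k
  r_nonneg : ∀ k, 0 ≤ r k
  h_nonneg : ∀ k, 0 ≤ h k
  e_nonneg : ∀ k, 0 ≤ e k
  u_nonneg : ∀ k, 0 ≤ u k
  α_sq : ∀ k, α (k + 1) ^ 2 = α k ^ 2 + h k ^ 2
  β_sq : ∀ k, β (k + 1) ^ 2 = β k ^ 2 + G k ^ 2
  γ_sq : ∀ k, γ (k + 1) ^ 2 = γ k ^ 2 + r k ^ 2
  e_le : ∀ k, p.μ * e k ≤ G k
  u_le : ∀ k, p.μ * u k ≤ r k + p.M * e k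
  h_le : ∀ k, h k ≤ p.Cfx + p.Cgxy * ((r k + p.Cfy) / p.μ)
  e_step : ∀ k, p.μ + p.Lg1 ≤ β (k + 1) →
    e (k + 1) ^ 2 + G k ^ 2 / (β (k + 1) * (p.μ + p.Lg1))
      ≤ e k ^ 2 + β (k + 1) * (p.μ + p.Lg1) / (p.μ * p.Lg1)
        * (p.Ly * (h k / (α (k + 1) * φ (k + 1)))) ^ 2
  e_jump : ∀ k C, p.μ + p.Lg1 ≤ C → β (k + 1) ≤ C →
    e (k + 1) ≤ C / p.μ + p.Ly * (h k / (α (k + 1) * φ (k + 1)))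
  u_step : ∀ k, 2 * (p.μ + p.Cgyy) ≤ φ (k + 1) →
    r k ^ 2 / φ (k + 1)
      ≤ 2 * (p.μ + p.Cgyy) * (u k ^ 2 - u (k + 1) ^ 2)
        + (4 * (p.μ + p.Cgyy) ^ 2 / (p.μ * p.Cgyy) + 8) * (p.M * e k) ^ 2
          / φ (k + 1)
        + 4 * (p.μ + p.Cgyy) ^ 2 / (p.μ * p.Cgyy) * φ (k + 1)
          * (p.Lv * (h k / (α (k + 1) * φ (k + 1)))) ^ 2
  u_jump : ∀ k, u (k + 1) ≤ u k + r k / φ (k + 1)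
    + p.Lv * (h k / (α (k + 1) * φ (k + 1)))
  F_step : ∀ k, F (k + 1) ≤ F k - h k ^ 2 / (α (k + 1) * φ (k + 1)) / 2
    + p.Lbar ^ 2 * (e k ^ 2 + u k ^ 2) / (α (k + 1) * φ (k + 1)) / 2
    + p.LΦ * (h k / (α (k + 1) * φ (k + 1))) ^ 2 / 2

section Run

variable {dx dy : ℕ} {f g : Vec dx → Vec dy → ℝ} {p : Params}

theorem Lip.valid (hμ : 0 < p.μ) (hs : Smooth f g p) (hl : Lip f g p) (hdy : 0 < dy)
    (hα0 : 1 ≤ p.α0) (hβ0 : 0 < p.β0) (hγ0 : 0 < p.γ0) : p.Valid where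
  μ_pos := hμ
  μ_le_Lg1 := hl.μ_le_Lg1 hs hdy
  μ_le_Cgyy := hl.μ_le_Cgyy hs hdy
  Lf1_nonneg := hl.Lf1_nonneg hdy
  Lg2_nonneg := hl.Lg2_nonneg hdy
  Cfx_nonneg := hl.Cfx_nonneg
  Cfy_nonneg := hl.Cfy_nonneg
  Cgxy_nonneg := hl.Cgxy_nonneg
  one_le_α0 := hα0
  β0_pos := hβ0
  γ0_pos := hγ0

theorem step_pos {s : State dx dy} (h : 0 < s.α ∧ 0 < s.β ∧ 0 < s.γ) :
    0 < (step f g s).α ∧ 0 < (step f g s).β ∧ 0 < (step f g s).γ := by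
  obtain ⟨h1, h2, h3⟩ := h
  refine ⟨?_, ?_, ?_⟩ <;> exact Real.sqrt_pos.2 (by positivity)

theorem run_pos {init : State dx dy} (h : 0 < init.α ∧ 0 < init.β ∧ 0 < init.γ) (k : ℕ) :
    0 < (run f g init k).α ∧ 0 < (run f g init k).β ∧ 0 < (run f g init k).γ := by
  induction k with
  | zero => exact h
  | succ k ih => exact step_pos ih

/-- The size of `v` need not be tracked: `μ ‖v‖ ≤ ‖∇_y∇_y g v‖`, and this vector is the residual
plus the bounded `∇_y f`. -/
theorem norm_hyperGrad_le (hμ : 0 < p.μ) (hs : Smooth f g p) (hl : Lip f g p) (x : Vec dx)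
    (y v : Vec dy) :
    ‖hyperGrad f g x y v‖ ≤ p.Cfx + p.Cgxy * ((‖gradR f g x y v‖ + p.Cfy) / p.μ) := by
  have h1 := mul_norm_le_norm_hessYY hs x y v
  have h2 : hessYY g x y v = gradR f g x y v + gradY f x y := by rw [gradR_eq hs]; abel
  have h3 : ‖v‖ ≤ (‖gradR f g x y v‖ + p.Cfy) / p.μ := by
    rw [le_div_iff₀ hμ]
    rw [h2] at h1
    linarith [norm_add_le (gradR f g x y v) (gradY f x y), hl.gradY_bound x y]
  refine (norm_sub_le _ _).trans (add_le_add (hl.gradX_bound x y) ?_)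
  exact (hessXY g x y).le_of_opNorm_le_of_le (hl.hessXY_bound x y) h3

/-- Everything later arguments use about `f` and `g` enters here, apart from the signs and order of
the constants. -/
theorem trajectory_run (hdy : 0 < dy) (hμ : 0 < p.μ) (hs : Smooth f g p) (hl : Lip f g p)
    (hα0 : 1 ≤ p.α0) (hβ0 : 0 < p.β0) (hγ0 : 0 < p.γ0) (x₀ : Vec dx) (y₀ v₀ : Vec dy)
    (hG0 : p.G0 = ‖gradY g x₀ y₀‖) (hR0 : p.R0 = ‖gradR f g x₀ y₀ v₀‖) (s : ℕ → State dx dy)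
    (hrun : s = run f g
      { x := x₀, y := y₀, v := v₀, α := p.α0, β := p.β0, γ := p.γ0 }) :
    Trajectory p (fun k => (s k).α) (fun k => (s k).β) (fun k => (s k).γ)
      (fun k => max (s k).β (s k).γ)
      (fun k => ‖gradY g (s k).x (s k).y‖) (fun k => ‖gradR f g (s k).x (s k).y (s k).v‖)
      (fun k => ‖hyperGrad f g (s k).x (s k).y (s k).v‖)
      (fun k => ‖(s k).y - yStar g (s k).x‖) (fun k => ‖(s k).v - vStar f g (s k).x‖)
      (fun k => Phi f g (s k).x) := by
  have hL := hl.Lg1_nonneg hdy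
  have hL0 : 0 < p.Lg1 := hμ.trans_le (hl.μ_le_Lg1 hs hdy)
  have hK0 : 0 < p.Cgyy := hμ.trans_le (hl.μ_le_Cgyy hs hdy)
  have hpos : ∀ k, 0 < (s k).α ∧ 0 < (s k).β ∧ 0 < (s k).γ := fun k => by
    rw [hrun]
    exact run_pos ⟨by linarith, hβ0, hγ0⟩ k
  have hsucc : ∀ k, s (k + 1) = step f g (s k) := fun k => by rw [hrun]; rfl
  have hα : ∀ k, (s (k + 1)).α ^ 2
      = (s k).α ^ 2 + ‖hyperGrad f g (s k).x (s k).y (s k).v‖ ^ 2 := fun k => by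
    rw [hsucc]; exact Real.sq_sqrt (by positivity)
  have hβ : ∀ k, (s (k + 1)).β ^ 2 = (s k).β ^ 2 + ‖gradY g (s k).x (s k).y‖ ^ 2 := fun k => by
    rw [hsucc]; exact Real.sq_sqrt (by positivity)
  have hγ : ∀ k, (s (k + 1)).γ ^ 2
      = (s k).γ ^ 2 + ‖gradR f g (s k).x (s k).y (s k).v‖ ^ 2 := fun k => by
    rw [hsucc]; exact Real.sq_sqrt (by positivity)
  have hx : ∀ k, (s (k + 1)).x = (s k).x - (1 / ((s (k + 1)).α
      * max (s (k + 1)).β (s (k + 1)).γ)) • hyperGrad f g (s k).x (s k).y (s k).v := fun k => by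
    rw [hsucc]; rfl
  have hy : ∀ k, (s (k + 1)).y = (s k).y - (1 / (s (k + 1)).β) • gradY g (s k).x (s k).y :=
    fun k => by rw [hsucc]; rfl
  have hv : ∀ k, (s (k + 1)).v = (s k).v - (1 / max (s (k + 1)).β (s (k + 1)).γ)
      • gradR f g (s k).x (s k).y (s k).v := fun k => by rw [hsucc]; rfl
  have hφ : ∀ k, 0 < max (s k).β (s k).γ := fun k => lt_max_of_lt_left (hpos k).2.1
  have hdx : ∀ k, ‖(s k).x - (s (k + 1)).x‖ = ‖hyperGrad f g (s k).x (s k).y (s k).v‖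
      / ((s (k + 1)).α * max (s (k + 1)).β (s (k + 1)).γ) := fun k => by
    have := (hpos (k + 1)).1
    have := hφ (k + 1)
    rw [hx, sub_sub_cancel, norm_smul, Real.norm_of_nonneg (by positivity)]
    ring
  have hco : ∀ k, p.μ * p.Lg1 * ‖(s k).y - yStar g (s k).x‖ ^ 2 + ‖gradY g (s k).x (s k).y‖ ^ 2
      ≤ (p.μ + p.Lg1) * inner ℝ (gradY g (s k).x (s k).y) ((s k).y - yStar g (s k).x) :=
    fun k => by
      have := cocoercive_gradY hs hl hL (s k).x (s k).y (yStar g (s k).x)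
      rwa [gradY_yStar hμ hs hl hL, sub_zero] at this
  have he : ∀ k, p.μ * ‖(s k).y - yStar g (s k).x‖ ≤ ‖gradY g (s k).x (s k).y‖ := fun k => by
    have := mul_norm_sq_le_inner_gradY_sub hs hl hL (s k).x (s k).y (yStar g (s k).x)
    rw [gradY_yStar hμ hs hl hL, sub_zero] at this
    exact mul_norm_le_of_inner this
  have hR := fun k => gradR_sub (f := f) hs (s k).x (s k).y (s k).v (vStar f g (s k).x)
  have hM := fun k => norm_gradR_vStar_le hμ hs hl hdy (s k).x (s k).y
  have hyd : ∀ k, (s (k + 1)).y - yStar g (s (k + 1)).x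
      = (s k).y - yStar g (s k).x - (1 / (s (k + 1)).β) • gradY g (s k).x (s k).y
        + (yStar g (s k).x - yStar g (s (k + 1)).x) := fun k => by rw [hy]; abel
  have hys := fun k => norm_yStar_sub_le hμ hs hl hL (s k).x (s (k + 1)).x
  have hvd : ∀ k, (s (k + 1)).v - vStar f g (s (k + 1)).x
      = (s k).v - vStar f g (s k).x - (1 / max (s (k + 1)).β (s (k + 1)).γ)
        • gradR f g (s k).x (s k).y (s k).v
        + (vStar f g (s k).x - vStar f g (s (k + 1)).x) := fun k => by rw [hv]; abel
  have hvs := fun k => norm_vStar_sub_le hμ hs hl hdy (s k).x (s (k + 1)).x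
  refine
    { α_zero := by rw [hrun]; rfl
      β_zero := by rw [hrun]; rfl
      γ_zero := by rw [hrun]; rfl
      G_zero := by rw [hG0, hrun]; rfl
      r_zero := by rw [hR0, hrun]; rfl
      φ_eq := fun _ => rfl
      α_pos := fun k => (hpos k).1
      β_pos := fun k => (hpos k).2.1
      γ_pos := fun k => (hpos k).2.2
      G_nonneg := fun k => norm_nonneg _
      r_nonneg := fun k => norm_nonneg _
      h_nonneg := fun k => norm_nonneg _
      e_nonneg := fun k => norm_nonneg _
      u_nonneg := fun k => norm_nonneg _
      α_sq := hα
      β_sq := hβ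
      γ_sq := hγ
      e_le := he
      u_le := fun k => ?_
      h_le := fun k => norm_hyperGrad_le hμ hs hl _ _ _
      e_step := fun k hk => ?_
      e_jump := fun k C hC hk => ?_
      u_step := fun k hk => ?_
      u_jump := fun k => ?_
      F_step := fun k => ?_ }
  · have h1 := mul_norm_le_norm_hessYY hs (s k).x (s k).y ((s k).v - vStar f g (s k).x)
    rw [eq_sub_iff_add_eq.2 (hR k).symm] at h1
    linarith [norm_sub_le (gradR f g (s k).x (s k).y (s k).v)
      (gradR f g (s k).x (s k).y (vStar f g (s k).x)), hM k]
  · have h1 := norm_gradient_step_sq_le (w := yStar g (s k).x - yStar g (s (k + 1)).x)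
      hμ hL0 hk (hco k)
    rw [← hyd] at h1
    have h2 := hys k
    rw [hdx] at h2
    refine h1.trans ?_
    have := (hpos (k + 1)).2.1
    gcongr
  · have hb := (hpos (k + 1)).2.1
    have h1 := norm_normalized_step_le hμ (hl.μ_le_Lg1 hs hdy) hb hC hk
      (by
        refine (pow_le_pow_iff_left₀ (norm_nonneg _) hb.le two_ne_zero).1 ?_
        rw [hβ]
        nlinarith [sq_nonneg (s k).β]) (he k) (hco k)
    have h2 := hys k
    rw [hdx] at h2
    rw [hyd]
    exact (norm_add_le _ _).trans (add_le_add h1 h2)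
  -- The exact gradient is the Hessian applied to `v - v*`; the defect is the residual of `v*`,
  -- nonzero because the system is taken at `y` and not at `y*`.
  · have h1 := norm_inexact_step_sq_le (u := (s k).v - vStar f g (s k).x)
      (δ := gradR f g (s k).x (s k).y (vStar f g (s k).x))
      (w := vStar f g (s k).x - vStar f g (s (k + 1)).x) hμ hK0 hk
      (mul_norm_sq_add_norm_sq_apply_le (inner_hessYY_comm hs.g_contDiff (s k).x (s k).y)
        (hs.mul_norm_sq_le_inner_hessYY (s k).x (s k).y)
        (hl.inner_hessYY_le_Cgyy (s k).x (s k).y) _)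
    rw [← hR, ← hvd] at h1
    have h2 := hvs k
    rw [hdx] at h2
    refine h1.trans ?_
    have := hφ (k + 1)
    have h3 := hM k
    gcongr
  · have h2 := hvs k
    rw [hdx] at h2
    have := hφ (k + 1)
    rw [hvd]
    refine (norm_add_le _ _).trans (add_le_add ((norm_sub_le _ _).trans_eq ?_) h2)
    rw [norm_smul, Real.norm_of_nonneg (by positivity)]
    ring
  · have h1 := Phi_descent hμ hs hl hdy (s k).x ((s (k + 1)).x - (s k).x)
    rw [add_sub_cancel, norm_sub_rev, hdx] at h1
    have hη : 0 < (s (k + 1)).α * max (s (k + 1)).β (s (k + 1)).γ :=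
      mul_pos (hpos (k + 1)).1 (hφ (k + 1))
    have h2 := norm_gradPhi_sub_hyperGrad_sq_le hμ hs hl hdy (s k).x (s k).y (s k).v
    have h3 : inner ℝ (gradPhi f g (s k).x) ((s (k + 1)).x - (s k).x)
        = - (1 / ((s (k + 1)).α * max (s (k + 1)).β (s (k + 1)).γ))
          * inner ℝ (gradPhi f g (s k).x) (hyperGrad f g (s k).x (s k).y (s k).v) := by
      rw [hx, sub_sub_cancel_left, inner_neg_right, real_inner_smul_right]
      ring
    have h4 := norm_sub_sq_real (gradPhi f g (s k).x) (hyperGrad f g (s k).x (s k).y (s k).v)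
    rw [h3] at h1
    refine h1.trans ?_
    set η := (s (k + 1)).α * max (s (k + 1)).β (s (k + 1)).γ
    set I := inner ℝ (gradPhi f g (s k).x) (hyperGrad f g (s k).x (s k).y (s k).v)
    set h := ‖hyperGrad f g (s k).x (s k).y (s k).v‖
    -- Polarization, with the square of `‖∇Φ‖` dropped.
    have h5 : h ^ 2 - p.Lbar ^ 2 * (‖(s k).y - yStar g (s k).x‖ ^ 2
        + ‖(s k).v - vStar f g (s k).x‖ ^ 2) ≤ 2 * I := by
      nlinarith [sq_nonneg ‖gradPhi f g (s k).x‖]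
    have h6 := mul_le_mul_of_nonneg_left h5 (by positivity : 0 ≤ 1 / η / 2)
    have h7 : 1 / η / 2 * (h ^ 2 - p.Lbar ^ 2 * (‖(s k).y - yStar g (s k).x‖ ^ 2
        + ‖(s k).v - vStar f g (s k).x‖ ^ 2))
      = h ^ 2 / η / 2 - p.Lbar ^ 2 * (‖(s k).y - yStar g (s k).x‖ ^ 2
        + ‖(s k).v - vStar f g (s k).x‖ ^ 2) / η / 2 := by ring
    have h8 : 1 / η / 2 * (2 * I) = 1 / η * I := by ring
    linarith

end Run

open Finset

/-! ### Sequences with `b_{k+1}² = b_k² + a_k²`. -/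

section Accumulators

/-- Accumulators `b` of the squares of `a`. -/
structure Accumulates (a b : ℕ → ℝ) : Prop where
  pos : ∀ k, 0 < b k
  sq : ∀ k, b (k + 1) ^ 2 = b k ^ 2 + a k ^ 2

variable {a b : ℕ → ℝ}

theorem Accumulates.le_succ (hb : Accumulates a b) (k : ℕ) : b k ≤ b (k + 1) := by
  refine (pow_le_pow_iff_left₀ (hb.pos k).le (hb.pos _).le two_ne_zero).1 ?_
  rw [hb.sq]
  linarith [sq_nonneg (a k)]

theorem Accumulates.monotone (hb : Accumulates a b) : Monotone b :=
  monotone_nat_of_le_succ hb.le_succ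

theorem Accumulates.le (hb : Accumulates a b) (k : ℕ) : a k ≤ b (k + 1) := by
  refine abs_le_of_sq_le_sq' ?_ (hb.pos _).le |>.2
  rw [hb.sq]
  linarith [sq_nonneg (b k)]

/-- From `(b' - b)(b' + b) = a²`. -/
theorem Accumulates.succ_le (hb : Accumulates a b) (k : ℕ) :
    b (k + 1) ≤ b k + a k ^ 2 / b (k + 1) := by
  have h1 := hb.pos (k + 1)
  have h2 : b (k + 1) - b k ≤ a k ^ 2 / b (k + 1) := by
    rw [le_div_iff₀ h1]
    nlinarith [hb.sq k, hb.le_succ k, hb.pos k]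
  linarith

theorem Accumulates.le_add_sum (hb : Accumulates a b) {m n : ℕ} (hmn : m ≤ n) :
    b n ≤ b m + ∑ k ∈ Ico m n, a k ^ 2 / b (k + 1) := by
  induction n, hmn using Nat.le_induction with
  | base => simp
  | succ n hmn ih =>
    rw [sum_Ico_succ_top hmn]
    linarith [hb.succ_le n]

theorem Accumulates.sq_eq (hb : Accumulates a b) (n : ℕ) :
    b n ^ 2 = b 0 ^ 2 + ∑ k ∈ range n, a k ^ 2 := by
  induction n with
  | zero => simp
  | succ n ih => rw [sum_range_succ, hb.sq, ih]; ring

/-- The crude bound for the rounds below a threshold: each denominator is at least `b 0`, and the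
squares sum to `b m ^ 2 - b 0 ^ 2`. -/
theorem Accumulates.sum_div_le (hb : Accumulates a b) {m : ℕ} {C : ℝ} (hm : b m ≤ C) :
    ∑ k ∈ range m, a k ^ 2 / b (k + 1) ≤ C ^ 2 / b 0 - b 0 := by
  have h0 := hb.pos 0
  calc ∑ k ∈ range m, a k ^ 2 / b (k + 1) ≤ ∑ k ∈ range m, a k ^ 2 / b 0 := by
        gcongr with k _
        exact hb.monotone (Nat.zero_le _)
    _ = b m ^ 2 / b 0 - b 0 := by
        rw [← sum_div, hb.sq_eq m]; field_simp; ring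
    _ ≤ _ := by
        have := (hb.pos m).le
        gcongr

/-- Each term equals `1 - 1/x` with `x = b_{k+1}² / b_k²`, hence is at most `log x`, and the
logarithms telescope. -/
theorem Accumulates.sum_div_sq_le_log (hb : Accumulates a b) (n : ℕ) :
    ∑ k ∈ range n, a k ^ 2 / b (k + 1) ^ 2 ≤ 2 * Real.log (b n / b 0) := by
  induction n with
  | zero => simp [div_self (hb.pos 0).ne']
  | succ n ih =>
    have h0 := hb.pos 0
    have h1 := hb.pos n
    have h2 := hb.pos (n + 1)
    have h3 := Real.one_sub_inv_le_log_of_pos (x := b (n + 1) ^ 2 / b n ^ 2) (by positivity)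
    have h4 : 1 - (b (n + 1) ^ 2 / b n ^ 2)⁻¹ = a n ^ 2 / b (n + 1) ^ 2 := by
      have := hb.sq n
      field_simp
      linarith
    rw [h4, ← div_pow (b (n + 1)), Real.log_pow, Real.log_div h2.ne' h1.ne'] at h3
    rw [Real.log_div h1.ne' h0.ne'] at ih
    rw [sum_range_succ, Real.log_div h2.ne' h0.ne']
    push_cast at h3
    linarith

/-- All threshold arguments split the rounds at this `m`: before it `b m ≤ C` gives crude bounds,
after it the one-step estimates that need a large accumulator apply. The tail is empty when `m = n`.
-/
theorem exists_last_le {b : ℕ → ℝ} {C : ℝ} (h0 : b 0 ≤ C) (n : ℕ) :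
    ∃ m ≤ n, b m ≤ C ∧ ∀ k, m ≤ k → k < n → C < b (k + 1) := by
  induction n with
  | zero => exact ⟨0, le_rfl, h0, fun k _ hk => absurd hk (Nat.not_lt_zero k)⟩
  | succ n ih =>
    by_cases hn : b (n + 1) ≤ C
    · exact ⟨n + 1, le_rfl, hn, fun k h1 h2 => absurd h2 (by omega)⟩
    · obtain ⟨m, hmn, hm, hk⟩ := ih
      refine ⟨m, hmn.trans n.le_succ, hm, fun k h1 h2 => ?_⟩
      rcases Nat.lt_succ_iff_lt_or_eq.1 h2 with h3 | rfl
      · exact hk k h1 h3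
      · exact not_le.1 hn

/-- Minkowski's inequality for accumulators: `h ≤ c + d w`. -/
theorem Accumulates.le_minkowski (hb : Accumulates a b) {w : ℕ → ℝ} {c d : ℝ} (hc : 0 ≤ c)
    (hd : 0 ≤ d) (ha : ∀ k, 0 ≤ a k) (hw : ∀ k, 0 ≤ w k) (h : ∀ k, a k ≤ c + d * w k) (n : ℕ) :
    b n ≤ b 0 + c * Real.sqrt n + d * Real.sqrt (∑ k ∈ range n, w k ^ 2) := by
  induction n with
  | zero => simp
  | succ n ih =>
    have h0 := (hb.pos 0).le
    have hn := hb.pos n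
    have hS : 0 ≤ ∑ k ∈ range n, w k ^ 2 := sum_nonneg fun k _ => sq_nonneg _
    set P := Real.sqrt n with hP
    set Z := Real.sqrt (∑ k ∈ range n, w k ^ 2) with hZ
    set P' := Real.sqrt ((n + 1 : ℕ) : ℝ) with hP'
    set Z' := Real.sqrt (∑ k ∈ range (n + 1), w k ^ 2) with hZ'
    have eP : P ^ 2 = n := Real.sq_sqrt (Nat.cast_nonneg n)
    have eP' : P' ^ 2 = n + 1 := by
      rw [hP', Real.sq_sqrt (Nat.cast_nonneg _)]; push_cast; ring
    have eZ : Z ^ 2 = ∑ k ∈ range n, w k ^ 2 := Real.sq_sqrt hS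
    have eZ' : Z' ^ 2 = Z ^ 2 + w n ^ 2 := by
      rw [hZ', Real.sq_sqrt (sum_nonneg fun k _ => sq_nonneg _), sum_range_succ, eZ]
    have hP0 : 0 ≤ P := Real.sqrt_nonneg _
    have hZ0 : 0 ≤ Z := Real.sqrt_nonneg _
    have hP'0 : 0 ≤ P' := Real.sqrt_nonneg _
    have hZ'0 : 0 ≤ Z' := Real.sqrt_nonneg _
    have hwn := hw n
    have hPP : P ≤ P' := (pow_le_pow_iff_left₀ hP0 hP'0 two_ne_zero).1 (by linarith)
    have hZZ : Z ≤ Z' := (pow_le_pow_iff_left₀ hZ0 hZ'0 two_ne_zero).1 (by nlinarith)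
    -- Cauchy–Schwarz for `(P, 1)` and `(Z, w n)`.
    have hcs : P * Z + w n ≤ P' * Z' := by
      refine (pow_le_pow_iff_left₀ (by positivity) (by positivity) two_ne_zero).1 ?_
      have : (P' * Z') ^ 2 = (P ^ 2 + 1) * (Z ^ 2 + w n ^ 2) := by rw [mul_pow, eP', eZ', eP]
      rw [this]
      nlinarith [sq_nonneg (P * w n - Z)]
    refine (pow_le_pow_iff_left₀ (hb.pos _).le (by positivity) two_ne_zero).1 ?_
    rw [hb.sq]
    have h1 : b n ^ 2 ≤ (b 0 + c * P + d * Z) ^ 2 := by gcongr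
    have h2 : a n ^ 2 ≤ (c + d * w n) ^ 2 := pow_le_pow_left₀ (ha n) (h n) 2
    have h3 : (b 0 + c * P + d * Z) ^ 2 + (c + d * w n) ^ 2
        = b 0 ^ 2 + 2 * b 0 * (c * P + d * Z) + c ^ 2 * (P ^ 2 + 1) + d ^ 2 * (Z ^ 2 + w n ^ 2)
          + 2 * (c * d) * (P * Z + w n) := by ring
    have h4 : (b 0 + c * P' + d * Z') ^ 2
        = b 0 ^ 2 + 2 * b 0 * (c * P' + d * Z') + c ^ 2 * P' ^ 2 + d ^ 2 * Z' ^ 2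
          + 2 * (c * d) * (P' * Z') := by ring
    rw [eP] at h3
    rw [eP', eZ'] at h4
    have h5 : 2 * b 0 * (c * P + d * Z) ≤ 2 * b 0 * (c * P' + d * Z') := by gcongr
    have h6 : 2 * (c * d) * (P * Z + w n) ≤ 2 * (c * d) * (P' * Z') := by gcongr
    linarith

end Accumulators

/-! ### Signs and comparisons of the constants. -/

namespace Params

variable {p : Params}

/-- The coefficient of `Σ ‖h‖² / α²` in the bound on `‖y - y*‖²`. -/
noncomputable def Ae (p : Params) : ℝ :=
  (p.μ + p.Lg1) * p.Ly ^ 2 / (p.μ * p.Lg1 * p.φ0)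

namespace Valid

theorem Lg1_pos (V : p.Valid) : 0 < p.Lg1 := V.μ_pos.trans_le V.μ_le_Lg1

theorem Cgyy_pos (V : p.Valid) : 0 < p.Cgyy := V.μ_pos.trans_le V.μ_le_Cgyy

theorem α0_pos (V : p.Valid) : 0 < p.α0 := one_pos.trans_le V.one_le_α0

theorem φ0_pos (V : p.Valid) : 0 < p.φ0 := lt_max_of_lt_left V.β0_pos

theorem Ly_nonneg (V : p.Valid) : 0 ≤ p.Ly := div_nonneg V.Cgxy_nonneg V.μ_pos.le

theorem Lv_nonneg (V : p.Valid) : 0 ≤ p.Lv := by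
  have := V.μ_pos; have := V.Lf1_nonneg; have := V.Cfy_nonneg; have := V.Lg2_nonneg
  have := V.Ly_nonneg
  unfold Lv; positivity

theorem M_nonneg (V : p.Valid) : 0 ≤ p.M := by
  have := V.μ_pos; have := V.Lf1_nonneg; have := V.Cfy_nonneg; have := V.Lg2_nonneg
  unfold M; positivity

theorem LΦ_nonneg (V : p.Valid) : 0 ≤ p.LΦ := by
  have := V.μ_pos; have := V.Lf1_nonneg; have := V.Cfy_nonneg; have := V.Lg2_nonneg
  unfold LΦ; positivity

theorem κ_nonneg (V : p.Valid) : 0 ≤ p.κ := by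
  have := V.μ_pos; have := V.Cgyy_pos
  unfold κ; positivity

theorem Cβ_eq (V : p.Valid) : p.Cβ = p.CβMap p.Cβ :=
  p.Cβ_eq V.μ_pos V.Lg1_pos V.Cgyy_pos V.β0_pos V.γ0_pos

theorem μ_add_Lg1_le_Cβ (V : p.Valid) : p.μ + p.Lg1 ≤ p.Cβ := by
  rw [V.Cβ_eq]; exact le_max_left _ _

theorem β0_le_Cβ (V : p.Valid) : p.β0 ≤ p.Cβ := by
  rw [V.Cβ_eq]; simp [CβMap]

theorem a0_sq_le_Cβ (V : p.Valid) : 64 * p.a0 ^ 2 ≤ p.Cβ := by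
  have h : 64 * p.a0Of p.Cβ ^ 2 ≤ p.CβMap p.Cβ :=
    (le_max_left _ _).trans ((le_max_right _ _).trans ((le_max_right _ _).trans (le_max_right _ _)))
  rw [a0]
  exact h.trans_eq V.Cβ_eq.symm

theorem one_le_Cβ (V : p.Valid) : 1 ≤ p.Cβ := by
  rw [V.Cβ_eq]; simp [CβMap]

theorem Cβ_pos (V : p.Valid) : 0 < p.Cβ := one_pos.trans_le V.one_le_Cβ

theorem Ay_nonneg (V : p.Valid) : 0 ≤ p.Ay := by
  have := V.μ_pos; have := V.Lg1_pos; have := V.Cβ_pos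
  unfold Ay; positivity

theorem Ae_nonneg (V : p.Valid) : 0 ≤ p.Ae := by
  have := V.μ_pos; have := V.Lg1_pos; have := V.φ0_pos
  unfold Ae; positivity

theorem two_mul_le_Cγ : 2 * (p.μ + p.Cgyy) ≤ p.Cγ := le_max_left _ _

theorem γ0_le_Cγ : p.γ0 ≤ p.Cγ := by simp [Cγ]

theorem Cγ_pos (V : p.Valid) : 0 < p.Cγ := V.γ0_pos.trans_le γ0_le_Cγ

theorem Av_nonneg (V : p.Valid) : 0 ≤ p.Av := by
  have := V.μ_pos; have := V.Lg1_pos; have := V.Cgyy_pos; have := V.φ0_pos; have := V.Cγ_pos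
  unfold Av; positivity

/-- `Cγ` is defined through `a0`, so `a0` carries `γ0` in the place where `Av` has `Cγ`; since `γ0 ≤
Cγ` this only enlarges it. -/
theorem add_le_a0 (V : p.Valid) : (p.κ + 1) * p.Ay + p.Av ≤ p.a0 := by
  have := V.μ_pos; have := V.Cgyy_pos; have := V.γ0_pos
  have h1 : 4 * (p.μ + p.Cgyy) ^ 2 * p.Lv ^ 2 / (p.μ * p.Cgyy * p.Cγ)
      ≤ 4 * (p.μ + p.Cgyy) ^ 2 * p.Lv ^ 2 / (p.μ * p.Cgyy * p.γ0) := by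
    gcongr
    exact γ0_le_Cγ
  rw [a0, a0Of, Ay, Av]
  linarith

theorem a0_nonneg (V : p.Valid) : 0 ≤ p.a0 := by
  have := V.κ_nonneg; have := V.Ay_nonneg; have := V.Av_nonneg
  refine le_trans ?_ V.add_le_a0
  positivity

theorem Dy_nonneg : 0 ≤ p.Dy := by unfold Dy; positivity

theorem Dv_nonneg : 0 ≤ p.Dv := by unfold Dv; positivity

theorem E_nonneg (V : p.Valid) : 0 ≤ p.E := by
  have := V.μ_pos; have := V.Cgyy_pos; have := Dy_nonneg (p := p); have := Dv_nonneg (p := p)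
  unfold E; positivity

theorem Cβ_sq_div_sub_nonneg (V : p.Valid) : 0 ≤ p.Cβ ^ 2 / p.β0 - p.β0 := by
  have h := V.β0_pos
  rw [sub_nonneg, le_div_iff₀ h]
  nlinarith [V.β0_le_Cβ]

theorem Cβ_add_le_b0 (V : p.Valid) : p.Cβ + p.Cγ ≤ p.b0 := by
  have h1 := V.E_nonneg
  have h2 := mul_nonneg V.κ_nonneg V.Cβ_sq_div_sub_nonneg
  have h3 : 0 ≤ (p.κ + 1) * (p.μ + p.Lg1) * p.Dy := by
    have := V.μ_pos; have := V.Lg1_pos; have := Dy_nonneg (p := p); have := V.κ_nonneg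
    positivity
  rw [b0]; linarith

theorem α0_le_Cα : p.α0 ≤ p.Cα := le_max_right _ _

theorem Cα_pos (V : p.Valid) : 0 < p.Cα := V.α0_pos.trans_le α0_le_Cα

theorem two_mul_LΦ_le (V : p.Valid) : 2 * p.LΦ ≤ p.Cα * p.φ0 := by
  have h : 2 * p.LΦ / p.φ0 ≤ p.Cα := le_max_left _ _
  rwa [div_le_iff₀ V.φ0_pos] at h

end Valid

end Params

/-! ### Sums and accumulators in terms of `ratioSum`. -/

namespace Trajectory

variable {p : Params} {α β γ φ G r h e u F : ℕ → ℝ}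

/-- The sum of the normalized squared steps of the upper-level variable. -/
noncomputable def ratioSum (h α : ℕ → ℝ) (n : ℕ) : ℝ := ∑ k ∈ range n, h k ^ 2 / α (k + 1) ^ 2

theorem ratioSum_nonneg (h α : ℕ → ℝ) (n : ℕ) : 0 ≤ ratioSum h α n :=
  sum_nonneg fun _ _ => by positivity

theorem sum_Ico_le_sum_range {a : ℕ → ℝ} (ha : ∀ k, 0 ≤ a k) (m n : ℕ) :
    ∑ k ∈ Ico m n, a k ≤ ∑ k ∈ range n, a k :=
  sum_le_sum_of_subset_of_nonneg (fun _ hk => mem_range.2 (mem_Ico.1 hk).2) fun k _ _ => ha k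

theorem sum_Ico_ratio_le_ratioSum (h α : ℕ → ℝ) (m n : ℕ) :
    ∑ k ∈ Ico m n, h k ^ 2 / α (k + 1) ^ 2 ≤ ratioSum h α n :=
  sum_Ico_le_sum_range (fun _ => by positivity) m n

theorem ratioSum_mono (h α : ℕ → ℝ) : Monotone (ratioSum h α) := fun m n hmn =>
  sum_le_sum_of_subset_of_nonneg (range_subset_range.2 hmn) fun _ _ _ => by positivity

variable (T : Trajectory p α β γ φ G r h e u F)
include T

theorem accα : Accumulates h α := ⟨T.α_pos, T.α_sq⟩

theorem accβ : Accumulates G β := ⟨T.β_pos, T.β_sq⟩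

theorem accγ : Accumulates r γ := ⟨T.γ_pos, T.γ_sq⟩

theorem β_le_φ (k : ℕ) : β k ≤ φ k := by rw [T.φ_eq]; exact le_max_left _ _

theorem γ_le_φ (k : ℕ) : γ k ≤ φ k := by rw [T.φ_eq]; exact le_max_right _ _

theorem φ_pos (k : ℕ) : 0 < φ k := (T.β_pos k).trans_le (T.β_le_φ k)

theorem φ_mono : Monotone φ := fun m n hmn => by
  rw [T.φ_eq, T.φ_eq]
  exact max_le_max (T.accβ.monotone hmn) (T.accγ.monotone hmn)

theorem φ0_le (k : ℕ) : p.φ0 ≤ φ k := by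
  have h1 := T.φ_mono (Nat.zero_le k)
  rwa [T.φ_eq, T.β_zero, T.γ_zero] at h1

theorem α0_le (k : ℕ) : p.α0 ≤ α k := by
  have h1 := T.accα.monotone (Nat.zero_le k)
  rwa [T.α_zero] at h1

theorem M_mul_e_le (V : p.Valid) (k : ℕ) : (p.M * e k) ^ 2 ≤ p.M ^ 2 * (1 / p.μ ^ 2) * G k ^ 2 := by
  have hμ := V.μ_pos
  have h1 : e k ≤ G k / p.μ := by rw [le_div_iff₀ hμ]; linarith [T.e_le k]
  have h2 := pow_le_pow_left₀ (T.e_nonneg k) h1 2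
  calc (p.M * e k) ^ 2 = p.M ^ 2 * e k ^ 2 := by ring
    _ ≤ p.M ^ 2 * (G k / p.μ) ^ 2 := by gcongr
    _ = _ := by ring

/-- The upper-level step is normalized by `α`, so `x` moves a bounded amount per round however large
the hypergradient. Hence `Ly / φ0` in `Dy` and `Lv / φ0` in `Dv`. -/
theorem shift_le (V : p.Valid) (k : ℕ) : h k / (α (k + 1) * φ (k + 1)) ≤ 1 / p.φ0 := by
  have h1 := T.α_pos (k + 1)
  have h2 := T.φ_pos (k + 1)
  have h3 := V.φ0_pos
  rw [div_mul_eq_div_div]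
  have h4 : h k / α (k + 1) ≤ 1 := by rw [div_le_one h1]; exact T.accα.le k
  gcongr
  exact T.φ0_le _

/-- The two summands of `Dy` serve two cases: at `k = 0` the initial gradient bounds the distance;
otherwise the round leading to `k` was normalized by some `β ≤ Cβ`, and `e_jump` applies. -/
theorem e_sq_le_Dy (V : p.Valid) {k : ℕ} (hk : β k ≤ p.Cβ) : e k ^ 2 ≤ p.Dy := by
  have hμ := V.μ_pos
  cases k with
  | zero =>
    have h1 : e 0 ≤ p.G0 / p.μ := by
      rw [le_div_iff₀ hμ, ← T.G_zero]; linarith [T.e_le 0]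
    have h2 := pow_le_pow_left₀ (T.e_nonneg 0) h1 2
    rw [div_pow] at h2
    rw [Params.Dy]
    linarith [sq_nonneg (p.Cβ / p.μ + p.Ly / p.φ0)]
  | succ k =>
    have h1 := T.e_jump k p.Cβ V.μ_add_Lg1_le_Cβ hk
    have h2 := mul_le_mul_of_nonneg_left (T.shift_le V k) V.Ly_nonneg
    have h3 : e (k + 1) ≤ p.Cβ / p.μ + p.Ly / p.φ0 := by
      rw [mul_one_div] at h2; linarith
    have h4 := pow_le_pow_left₀ (T.e_nonneg _) h3 2
    rw [Params.Dy]
    linarith [show 0 ≤ p.G0 ^ 2 / p.μ ^ 2 by positivity]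

theorem e_step' (V : p.Valid) {k : ℕ} (hk : p.Cβ < β (k + 1)) :
    e (k + 1) ^ 2 + G k ^ 2 / (β (k + 1) * (p.μ + p.Lg1)) ≤ e k ^ 2
      + (p.μ + p.Lg1) * p.Ly ^ 2 / (p.μ * p.Lg1 * φ (k + 1)) * (h k ^ 2 / α (k + 1) ^ 2) := by
  have h1 := T.e_step k (V.μ_add_Lg1_le_Cβ.trans hk.le)
  have hμ := V.μ_pos
  have hL := V.Lg1_pos
  have hβ := T.β_pos (k + 1)
  have hφ := T.φ_pos (k + 1)
  have hα := T.α_pos (k + 1)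
  refine h1.trans (add_le_add le_rfl ?_)
  calc β (k + 1) * (p.μ + p.Lg1) / (p.μ * p.Lg1) * (p.Ly * (h k / (α (k + 1) * φ (k + 1)))) ^ 2
      ≤ φ (k + 1) * (p.μ + p.Lg1) / (p.μ * p.Lg1)
        * (p.Ly * (h k / (α (k + 1) * φ (k + 1)))) ^ 2 := by
        gcongr
        exact T.β_le_φ _
    _ = _ := by field_simp

/-- One inequality telescoped in two ways: dropping the gradients and using `φ ≥ φ0` (coefficient
`Ae`), or keeping them and using `φ > Cβ` (coefficient `Ay`). -/
theorem e_sq_add_sum_le (V : p.Valid) {m n : ℕ} (hmn : m ≤ n)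
    (hk : ∀ k, m ≤ k → k < n → p.Cβ < β (k + 1)) :
    e n ^ 2 ≤ e m ^ 2 + p.Ae * ∑ k ∈ Ico m n, h k ^ 2 / α (k + 1) ^ 2 ∧
    (p.μ + p.Lg1) * e n ^ 2 + ∑ k ∈ Ico m n, G k ^ 2 / β (k + 1)
      ≤ (p.μ + p.Lg1) * e m ^ 2 + p.Ay * ∑ k ∈ Ico m n, h k ^ 2 / α (k + 1) ^ 2 := by
  have hμ := V.μ_pos
  have hL := V.Lg1_pos
  have hμL : 0 < p.μ + p.Lg1 := by positivity
  have hφ0 := V.φ0_pos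
  have hCβ := V.Cβ_pos
  induction n, hmn using Nat.le_induction with
  | base => simp
  | succ n hmn ih =>
    obtain ⟨ih1, ih2⟩ := ih fun k h1 h2 => hk k h1 (h2.trans n.lt_succ_self)
    have hn := hk n hmn n.lt_succ_self
    have h1 := T.e_step' V hn
    have hβ := T.β_pos (n + 1)
    have hφ := T.φ_pos (n + 1)
    have hq : 0 ≤ h n ^ 2 / α (n + 1) ^ 2 := by positivity
    rw [sum_Ico_succ_top hmn, sum_Ico_succ_top hmn]
    constructor
    · have h2 : (p.μ + p.Lg1) * p.Ly ^ 2 / (p.μ * p.Lg1 * φ (n + 1)) ≤ p.Ae := by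
        rw [Params.Ae]
        gcongr
        exact T.φ0_le _
      have h3 := mul_le_mul_of_nonneg_right h2 hq
      have h4 : 0 ≤ G n ^ 2 / (β (n + 1) * (p.μ + p.Lg1)) := by positivity
      linarith
    · have h2 : (p.μ + p.Lg1) * ((p.μ + p.Lg1) * p.Ly ^ 2 / (p.μ * p.Lg1 * φ (n + 1))) ≤ p.Ay := by
        rw [Params.Ay, mul_div_assoc', ← mul_assoc, ← pow_two]
        gcongr
        exact hn.le.trans (T.β_le_φ _)
      have h3 := mul_le_mul_of_nonneg_right h2 hq
      have h5 := mul_le_mul_of_nonneg_left h1 hμL.le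
      have h6 : (p.μ + p.Lg1) * (e (n + 1) ^ 2 + G n ^ 2 / (β (n + 1) * (p.μ + p.Lg1)))
          = (p.μ + p.Lg1) * e (n + 1) ^ 2 + G n ^ 2 / β (n + 1) := by field_simp
      linarith

theorem β_zero_le (V : p.Valid) : β 0 ≤ p.Cβ := T.β_zero.trans_le V.β0_le_Cβ

theorem e_sq_le (V : p.Valid) (n : ℕ) : e n ^ 2 ≤ p.Dy + p.Ae * ratioSum h α n := by
  obtain ⟨m, hmn, hm, hk⟩ := exists_last_le (T.β_zero_le V) n
  have h1 := (T.e_sq_add_sum_le V hmn hk).1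
  have h2 := mul_le_mul_of_nonneg_left (sum_Ico_ratio_le_ratioSum h α m n) V.Ae_nonneg
  linarith [T.e_sq_le_Dy V hm]

/-- The summed lower-level gradients after `β` has passed `Cβ`. -/
theorem sum_Ico_G_le (V : p.Valid) {m n : ℕ} (hmn : m ≤ n) (hm : β m ≤ p.Cβ)
    (hk : ∀ k, m ≤ k → k < n → p.Cβ < β (k + 1)) :
    ∑ k ∈ Ico m n, G k ^ 2 / β (k + 1)
      ≤ (p.μ + p.Lg1) * p.Dy + p.Ay * ratioSum h α n := by
  have hμL : 0 ≤ p.μ + p.Lg1 := by linarith [V.μ_pos, V.Lg1_pos]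
  have h1 := (T.e_sq_add_sum_le V hmn hk).2
  have h2 := mul_le_mul_of_nonneg_left (sum_Ico_ratio_le_ratioSum h α m n) V.Ay_nonneg
  have h3 := mul_le_mul_of_nonneg_left (T.e_sq_le_Dy V hm) hμL
  have h4 := mul_nonneg hμL (sq_nonneg (e n))
  linarith

theorem sum_G_le (V : p.Valid) (n : ℕ) :
    ∑ k ∈ range n, G k ^ 2 / β (k + 1) ≤ p.b2Of (ratioSum h α n) := by
  obtain ⟨m, hmn, hm, hk⟩ := exists_last_le (T.β_zero_le V) n
  have h1 := T.sum_Ico_G_le V hmn hm hk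
  have h2 := T.accβ.sum_div_le hm
  rw [T.β_zero] at h2
  rw [← sum_range_add_sum_Ico _ hmn, Params.b2Of]
  linarith

theorem β_le (V : p.Valid) (n : ℕ) :
    β n ≤ p.Cβ + (p.μ + p.Lg1) * p.Dy + p.Ay * ratioSum h α n := by
  obtain ⟨m, hmn, hm, hk⟩ := exists_last_le (T.β_zero_le V) n
  linarith [T.sum_Ico_G_le V hmn hm hk, T.accβ.le_add_sum hmn]

theorem γ_zero_le : γ 0 ≤ p.Cγ := T.γ_zero.trans_le Params.Valid.γ0_le_Cγ

/-- The distance to `v*` is bounded by the residual plus a multiple of `e`, the residual being `R0`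
at the start and at most `γ ≤ Cγ` in the preceding round otherwise. At this moment `β` may be far
beyond `Cβ`, so `e` is bounded only through `ratioSum`. -/
theorem u_sq_le (V : p.Valid) {m : ℕ} (hm : γ m ≤ p.Cγ) :
    u m ^ 2 ≤ 2 * p.Dv + 2 * (p.M ^ 2 / p.μ ^ 2) * (p.Dy + p.Ae * ratioSum h α m) := by
  have hμ := V.μ_pos
  have hM := V.M_nonneg
  have hu : ∀ k, u k ≤ r k / p.μ + p.M / p.μ * e k := fun k => by
    have h1 : u k ≤ (r k + p.M * e k) / p.μ := by rw [le_div_iff₀ hμ]; linarith [T.u_le k]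
    refine h1.trans_eq (by ring)
  have hsq : ∀ a b c : ℝ, 0 ≤ c → c ≤ a + b → c ^ 2 ≤ 2 * a ^ 2 + 2 * b ^ 2 := fun a b c h0 hc => by
    nlinarith [pow_le_pow_left₀ h0 hc 2, sq_nonneg (a - b)]
  have he : ∀ k, (p.M / p.μ * e k) ^ 2
      ≤ (p.M ^ 2 / p.μ ^ 2) * (p.Dy + p.Ae * ratioSum h α k) := fun k => by
    rw [mul_pow, div_pow]
    exact mul_le_mul_of_nonneg_left (T.e_sq_le V k) (by positivity)
  cases m with
  | zero =>
    have h1 := hsq _ _ _ (T.u_nonneg 0) (hu 0)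
    rw [T.r_zero, div_pow] at h1
    have h2 : p.R0 ^ 2 / p.μ ^ 2 ≤ p.Dv := by
      rw [Params.Dv]; linarith [sq_nonneg (1 + p.Cγ / p.μ + p.Lv / p.φ0)]
    linarith [he 0]
  | succ k =>
    have hφ := T.φ_pos (k + 1)
    have h1 : r k ≤ γ (k + 1) := T.accγ.le k
    have h2 : r k / φ (k + 1) ≤ 1 := by
      rw [div_le_one hφ]; exact h1.trans (T.γ_le_φ _)
    have h3 : r k / p.μ ≤ p.Cγ / p.μ := by gcongr; exact h1.trans hm
    have h4 := mul_le_mul_of_nonneg_left (T.shift_le V k) V.Lv_nonneg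
    rw [mul_one_div] at h4
    have h5 := hsq (1 + p.Cγ / p.μ + p.Lv / p.φ0) (p.M / p.μ * e k) _ (T.u_nonneg (k + 1))
      (by linarith [T.u_jump k, hu k])
    have h6 : (1 + p.Cγ / p.μ + p.Lv / p.φ0) ^ 2 ≤ p.Dv := by
      rw [Params.Dv]; linarith [show 0 ≤ p.R0 ^ 2 / p.μ ^ 2 by positivity]
    have h7 : p.M ^ 2 / p.μ ^ 2 * (p.Dy + p.Ae * ratioSum h α k)
        ≤ p.M ^ 2 / p.μ ^ 2 * (p.Dy + p.Ae * ratioSum h α (k + 1)) := by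
      have := V.Ae_nonneg
      gcongr
      exact ratioSum_mono h α k.le_succ
    linarith [he k]

/-- `u_step` telescopes. Its defect `M e` is charged to the `y`-gradients through `e ≤ G / μ` and `β
≤ φ`, which is the origin of `κ`. -/
theorem sum_Ico_r_le_of_u (V : p.Valid) {m n : ℕ} (hmn : m ≤ n)
    (hk : ∀ k, m ≤ k → k < n → p.Cγ < γ (k + 1)) :
    2 * (p.μ + p.Cgyy) * u n ^ 2 + ∑ k ∈ Ico m n, r k ^ 2 / φ (k + 1)
      ≤ 2 * (p.μ + p.Cgyy) * u m ^ 2 + p.κ * ∑ k ∈ Ico m n, G k ^ 2 / β (k + 1)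
        + 4 * (p.μ + p.Cgyy) ^ 2 * p.Lv ^ 2 / (p.μ * p.Cgyy * p.Cγ)
          * ∑ k ∈ Ico m n, h k ^ 2 / α (k + 1) ^ 2 := by
  have hμ := V.μ_pos
  have hK := V.Cgyy_pos
  have hCγ := V.Cγ_pos
  induction n, hmn using Nat.le_induction with
  | base => simp
  | succ n hmn ih =>
    have ih := ih fun k h1 h2 => hk k h1 (h2.trans n.lt_succ_self)
    have hn := hk n hmn n.lt_succ_self
    have hCφ : p.Cγ ≤ φ (n + 1) := hn.le.trans (T.γ_le_φ _)
    have h1 := T.u_step n (Params.Valid.two_mul_le_Cγ.trans hCφ)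
    have hβ := T.β_pos (n + 1)
    have hφ := T.φ_pos (n + 1)
    have hα := T.α_pos (n + 1)
    rw [sum_Ico_succ_top hmn, sum_Ico_succ_top hmn, sum_Ico_succ_top hmn]
    have h2 : (4 * (p.μ + p.Cgyy) ^ 2 / (p.μ * p.Cgyy) + 8) * (p.M * e n) ^ 2 / φ (n + 1)
        ≤ p.κ * (G n ^ 2 / β (n + 1)) := by
      calc (4 * (p.μ + p.Cgyy) ^ 2 / (p.μ * p.Cgyy) + 8) * (p.M * e n) ^ 2 / φ (n + 1)
          ≤ (4 * (p.μ + p.Cgyy) ^ 2 / (p.μ * p.Cgyy) + 8)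
            * (p.M ^ 2 * (1 / p.μ ^ 2) * G n ^ 2) / β (n + 1) := by
            gcongr
            · exact T.M_mul_e_le V n
            · exact T.β_le_φ _
        _ = p.κ * (G n ^ 2 / β (n + 1)) := by rw [Params.κ]; ring
    have h3 : 4 * (p.μ + p.Cgyy) ^ 2 / (p.μ * p.Cgyy) * φ (n + 1)
          * (p.Lv * (h n / (α (n + 1) * φ (n + 1)))) ^ 2
        ≤ 4 * (p.μ + p.Cgyy) ^ 2 * p.Lv ^ 2 / (p.μ * p.Cgyy * p.Cγ)
          * (h n ^ 2 / α (n + 1) ^ 2) := by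
      calc 4 * (p.μ + p.Cgyy) ^ 2 / (p.μ * p.Cgyy) * φ (n + 1)
            * (p.Lv * (h n / (α (n + 1) * φ (n + 1)))) ^ 2
          = 4 * (p.μ + p.Cgyy) ^ 2 * p.Lv ^ 2 / (p.μ * p.Cgyy * φ (n + 1))
            * (h n ^ 2 / α (n + 1) ^ 2) := by field_simp
        _ ≤ _ := by gcongr
    linarith

theorem sum_Ico_r_le (V : p.Valid) {m n : ℕ} (hmn : m ≤ n) (hm : γ m ≤ p.Cγ)
    (hk : ∀ k, m ≤ k → k < n → p.Cγ < γ (k + 1)) :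
    ∑ k ∈ Ico m n, r k ^ 2 / φ (k + 1)
      ≤ p.E + p.Av * ratioSum h α n + p.κ * p.b2Of (ratioSum h α n) := by
  have hμ := V.μ_pos
  have hK := V.Cgyy_pos
  have hCγ := V.Cγ_pos
  have hL := V.Lg1_pos
  have hφ0 := V.φ0_pos
  have h1 := T.sum_Ico_r_le_of_u V hmn hk
  have h2 := mul_le_mul_of_nonneg_left (T.u_sq_le V hm) (by positivity : 0 ≤ 2 * (p.μ + p.Cgyy))
  -- The drift of `y*` inside the bound on `u m` becomes the first summand of `Av`.
  have h3 : 2 * (p.μ + p.Cgyy)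
      * (2 * p.Dv + 2 * (p.M ^ 2 / p.μ ^ 2) * (p.Dy + p.Ae * ratioSum h α m))
      = p.E + 4 * (p.μ + p.Cgyy) * (p.μ + p.Lg1) * p.Ly ^ 2 / (p.μ ^ 3 * p.Lg1 * p.φ0) * p.M ^ 2
        * ratioSum h α m := by
    rw [Params.E, Params.Ae]; field_simp; ring
  have h4 : 4 * (p.μ + p.Cgyy) * (p.μ + p.Lg1) * p.Ly ^ 2 / (p.μ ^ 3 * p.Lg1 * p.φ0) * p.M ^ 2
        * ratioSum h α m
      ≤ 4 * (p.μ + p.Cgyy) * (p.μ + p.Lg1) * p.Ly ^ 2 / (p.μ ^ 3 * p.Lg1 * p.φ0) * p.M ^ 2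
        * ratioSum h α n := by
    gcongr
    exact ratioSum_mono h α hmn
  have h5 := mul_le_mul_of_nonneg_left (sum_Ico_ratio_le_ratioSum h α m n)
    (by positivity : 0 ≤ 4 * (p.μ + p.Cgyy) ^ 2 * p.Lv ^ 2 / (p.μ * p.Cgyy * p.Cγ))
  have h6 := mul_le_mul_of_nonneg_left ((sum_Ico_le_sum_range (a := fun k => G k ^ 2 / β (k + 1))
    (fun k => div_nonneg (sq_nonneg _) (T.β_pos _).le) m n).trans (T.sum_G_le V n)) V.κ_nonneg
  have h7 : 0 ≤ 2 * (p.μ + p.Cgyy) * u n ^ 2 := by positivity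
  rw [Params.Av, add_mul]
  linarith

theorem sum_r_le (V : p.Valid) (n : ℕ) :
    ∑ k ∈ range n, r k ^ 2 / φ (k + 1) ≤ p.b3Of (ratioSum h α n) := by
  obtain ⟨m, hmn, hm, hk⟩ := exists_last_le T.γ_zero_le n
  have h1 := T.sum_Ico_r_le V hmn hm hk
  have h2 := T.accγ.sum_div_le hm
  rw [T.γ_zero] at h2
  have h3 : ∑ k ∈ range m, r k ^ 2 / φ (k + 1) ≤ ∑ k ∈ range m, r k ^ 2 / γ (k + 1) := by
    gcongr with k _
    · exact T.γ_pos _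
    · exact T.γ_le_φ _
  rw [← sum_range_add_sum_Ico _ hmn, Params.b3Of]
  linarith

/-- The available sum has `φ` in the denominator where the growth of `γ` asks for `γ`. In a round
ending with `γ ≤ β` the bound is inherited from `β`; in any other `φ = γ` and the increment is a
term of the sum. -/
theorem φ_le (V : p.Valid) (n : ℕ) : φ n ≤ p.b0 + p.a0 * ratioSum h α n := by
  set B := p.Cβ + (p.μ + p.Lg1) * p.Dy + p.Ay * ratioSum h α n with hB
  have hβB : ∀ k ≤ n, β k ≤ B := fun k hk => (T.accβ.monotone hk).trans (T.β_le V n)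
  have hB0 : 0 < B := (T.β_pos n).trans_le (hβB n le_rfl)
  have hCγ := V.Cγ_pos
  obtain ⟨m, hmn, hm, hk⟩ := exists_last_le T.γ_zero_le n
  have hγ : ∀ j, m ≤ j → j ≤ n → γ j ≤ B + p.Cγ + ∑ k ∈ Ico m j, r k ^ 2 / φ (k + 1) := by
    intro j hmj
    induction j, hmj using Nat.le_induction with
    | base => intro _; simp; linarith
    | succ j hmj ih =>
      intro hj
      have ih := ih (by omega)
      rcases le_total (γ (j + 1)) (β (j + 1)) with h1 | h1
      · have h2 : 0 ≤ ∑ k ∈ Ico m (j + 1), r k ^ 2 / φ (k + 1) :=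
          sum_nonneg fun k _ => div_nonneg (sq_nonneg _) (T.φ_pos _).le
        linarith [hβB (j + 1) hj]
      · have h2 : φ (j + 1) = γ (j + 1) := by rw [T.φ_eq, max_eq_right h1]
        rw [sum_Ico_succ_top hmj, h2]
        linarith [T.accγ.succ_le j]
  have h1 := T.sum_Ico_r_le V hmn hm hk
  have h2 : B + p.Cγ + (p.E + p.Av * ratioSum h α n + p.κ * p.b2Of (ratioSum h α n))
      = p.b0 + ((p.κ + 1) * p.Ay + p.Av) * ratioSum h α n := by
    rw [hB, Params.b0, Params.b2Of]; ring
  have h3 := mul_le_mul_of_nonneg_right V.add_le_a0 (ratioSum_nonneg h α n)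
  have h4 : 0 ≤ ∑ k ∈ Ico m n, r k ^ 2 / φ (k + 1) :=
    sum_nonneg fun k _ => div_nonneg (sq_nonneg _) (T.φ_pos _).le
  rw [T.φ_eq]
  refine max_le ?_ ?_
  · linarith [hβB n le_rfl]
  · linarith [hγ n hmn le_rfl]

end Trajectory

/-! ### Closing the loop: logarithmic bounds. -/

namespace Params

variable {p : Params}

theorem abar_nonneg (V : p.Valid) : 0 ≤ p.abar := div_nonneg (Real.sqrt_nonneg _) V.μ_pos.le

theorem bbar_nonneg (V : p.Valid) : 0 ≤ p.bbar :=
  div_nonneg (mul_nonneg (Real.sqrt_nonneg _) V.Cfy_nonneg) V.μ_pos.le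

theorem b0_nonneg (V : p.Valid) : 0 ≤ p.b0 := by
  linarith [V.Cβ_add_le_b0, V.Cβ_pos, V.Cγ_pos]

theorem one_le_log_arg (V : p.Valid) : 1 ≤ p.Cgxy * p.abar + p.Cgxy * p.bbar + p.Cfx + p.α0 := by
  linarith [mul_nonneg V.Cgxy_nonneg (abar_nonneg V), mul_nonneg V.Cgxy_nonneg (bbar_nonneg V),
    V.Cfx_nonneg, V.one_le_α0]

theorem two_mul_b0_le_b1 (V : p.Valid) : 2 * p.b0 ≤ p.b1 := by
  have h1 := mul_nonneg V.a0_nonneg (Real.log_nonneg (one_le_log_arg V))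
  rw [b1]
  linarith [V.a0_nonneg]

theorem b1_nonneg (V : p.Valid) : 0 ≤ p.b1 := by
  linarith [two_mul_b0_le_b1 V, b0_nonneg V]

theorem a1_nonneg (V : p.Valid) : 0 ≤ p.a1 := mul_nonneg (by norm_num) V.a0_nonneg

theorem b2Of_mono (V : p.Valid) : Monotone p.b2Of := fun c d hcd => by
  have := mul_le_mul_of_nonneg_left hcd V.Ay_nonneg
  rw [b2Of, b2Of]
  linarith

theorem b3Of_mono (V : p.Valid) : Monotone p.b3Of := fun c d hcd => by
  have h1 := mul_le_mul_of_nonneg_left hcd V.Av_nonneg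
  have h2 := mul_le_mul_of_nonneg_left (b2Of_mono V hcd) V.κ_nonneg
  rw [b3Of, b3Of]
  linarith

theorem b2Of_eq (l : ℝ) : p.b2Of (5 * l + p.c2) = p.a2 * l + p.b2 := by
  rw [b2, a2, b2Of, b2Of]; ring

theorem b3Of_eq (l : ℝ) : p.b3Of (5 * l + p.c2) = p.a3 * l + p.b3 := by
  rw [b3, a3, a2, b3Of, b3Of, b2Of, b2Of]; ring

end Params

namespace Trajectory

variable {p : Params} {α β γ φ G r h e u F : ℕ → ℝ}
variable (T : Trajectory p α β γ φ G r h e u F)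
include T

/-- Minkowski's inequality for `h_le`: the constant parts contribute `√n`, and the residuals
contribute `φ n`, since `Σ r² ≤ γ_n²`. The `√2` in `abar` and `bbar` comes from `(r + Cfy)² ≤ 2r² +
2Cfy²`. -/
theorem α_le (V : p.Valid) (n : ℕ) :
    α n ≤ p.α0 + (p.Cfx + p.Cgxy * p.bbar) * Real.sqrt n + p.Cgxy * p.abar * φ n := by
  have hμ := V.μ_pos
  have hCfy := V.Cfy_nonneg
  have hxy := V.Cgxy_nonneg
  have ha := Params.abar_nonneg V
  have hb := Params.bbar_nonneg V
  have hr := T.r_nonneg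
  have h1 := T.accα.le_minkowski V.Cfx_nonneg hxy T.h_nonneg (w := fun k => (r k + p.Cfy) / p.μ)
    (fun k => div_nonneg (add_nonneg (hr k) hCfy) hμ.le) T.h_le n
  have h2 : ∑ k ∈ range n, ((r k + p.Cfy) / p.μ) ^ 2
      ≤ 2 / p.μ ^ 2 * γ n ^ 2 + 2 * p.Cfy ^ 2 / p.μ ^ 2 * n := by
    calc ∑ k ∈ range n, ((r k + p.Cfy) / p.μ) ^ 2
        ≤ ∑ k ∈ range n, (2 / p.μ ^ 2 * r k ^ 2 + 2 * p.Cfy ^ 2 / p.μ ^ 2) := by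
          refine sum_le_sum fun k _ => ?_
          rw [div_pow, div_mul_eq_mul_div, ← add_div]
          gcongr
          nlinarith [sq_nonneg (r k - p.Cfy)]
      _ = 2 / p.μ ^ 2 * ∑ k ∈ range n, r k ^ 2 + 2 * p.Cfy ^ 2 / p.μ ^ 2 * n := by
          rw [sum_add_distrib, ← mul_sum, sum_const, card_range, nsmul_eq_mul]; ring
      _ ≤ _ := by
          gcongr
          rw [T.accγ.sq_eq n]
          linarith [sq_nonneg (γ 0)]
  have hφ := T.φ_pos n
  have h3 : Real.sqrt (∑ k ∈ range n, ((r k + p.Cfy) / p.μ) ^ 2)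
      ≤ p.abar * φ n + p.bbar * Real.sqrt n := by
    rw [Real.sqrt_le_left (by positivity)]
    refine h2.trans ?_
    have e1 : p.abar ^ 2 = 2 / p.μ ^ 2 := by
      rw [Params.abar, div_pow, Real.sq_sqrt (by norm_num)]
    have e2 : p.bbar ^ 2 = 2 * p.Cfy ^ 2 / p.μ ^ 2 := by
      rw [Params.bbar, div_pow, mul_pow, Real.sq_sqrt (by norm_num)]
    have e3 : (p.abar * φ n + p.bbar * Real.sqrt n) ^ 2 = p.abar ^ 2 * φ n ^ 2
        + p.bbar ^ 2 * Real.sqrt n ^ 2 + 2 * (p.abar * φ n * (p.bbar * Real.sqrt n)) := by ring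
    rw [e3, e1, e2, Real.sq_sqrt (Nat.cast_nonneg n)]
    have h4 : γ n ^ 2 ≤ φ n ^ 2 := pow_le_pow_left₀ (T.γ_pos n).le (T.γ_le_φ n) 2
    have h5 : 2 / p.μ ^ 2 * γ n ^ 2 ≤ 2 / p.μ ^ 2 * φ n ^ 2 := by gcongr
    have h6 : 0 ≤ 2 * (p.abar * φ n * (p.bbar * Real.sqrt n)) := by positivity
    linarith
  have h4 := mul_le_mul_of_nonneg_left h3 hxy
  rw [T.α_zero] at h1
  linarith

theorem ratioSum_le_log_div (n : ℕ) : ratioSum h α n ≤ 2 * Real.log (α n / p.α0) := by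
  have := T.accα.sum_div_sq_le_log n
  rwa [T.α_zero] at this

theorem ratioSum_le_log (V : p.Valid) (n : ℕ) : ratioSum h α n ≤ 2 * Real.log (α n) := by
  refine (T.ratioSum_le_log_div n).trans ?_
  have := T.α_pos n
  have h1 := V.α0_pos
  gcongr
  exact div_le_self this.le V.one_le_α0

/-- Below `Cβ` the constant `b1` suffices. Above it `α ≤ C √n φ`, and inserting this into `φ ≤ b0 +
2 a0 log α` bounds `φ` by its own logarithm. -/
theorem φ_le_log (V : p.Valid) {n : ℕ} (hn : 1 ≤ n) : φ n ≤ p.a1 * Real.log n + p.b1 := by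
  have hn' : (1 : ℝ) ≤ n := by exact_mod_cast hn
  have hlog : 0 ≤ Real.log n := Real.log_nonneg hn'
  have ha0 := V.a0_nonneg
  have hb0 := Params.b0_nonneg V
  rcases le_total (φ n) p.Cβ with h1 | h1
  · linarith [V.Cβ_add_le_b0, V.Cγ_pos, Params.two_mul_b0_le_b1 V,
      mul_nonneg (Params.a1_nonneg V) hlog]
  have hφ1 : 1 ≤ φ n := V.one_le_Cβ.trans h1
  have hφ0 : 0 < φ n := by linarith
  set C := p.Cgxy * p.abar + p.Cgxy * p.bbar + p.Cfx + p.α0 with hC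
  have hC1 : 1 ≤ C := Params.one_le_log_arg V
  have hs1 : 1 ≤ Real.sqrt n := by rw [Real.one_le_sqrt]; exact hn'
  have hα : α n ≤ C * (Real.sqrt n * φ n) := by
    have h2 := T.α_le V n
    have h3 : 1 ≤ Real.sqrt n * φ n := one_le_mul_of_one_le_of_one_le hs1 hφ1
    have h4 : Real.sqrt n ≤ Real.sqrt n * φ n := le_mul_of_one_le_right (by positivity) hφ1
    have h5 : φ n ≤ Real.sqrt n * φ n := le_mul_of_one_le_left (by positivity) hs1
    have h6 := mul_le_mul_of_nonneg_left h3 V.α0_pos.le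
    have h7 := mul_le_mul_of_nonneg_left h4
      (add_nonneg V.Cfx_nonneg (mul_nonneg V.Cgxy_nonneg (Params.bbar_nonneg V)))
    have h8 := mul_le_mul_of_nonneg_left h5 (mul_nonneg V.Cgxy_nonneg (Params.abar_nonneg V))
    rw [hC]
    linarith
  have hlogα : Real.log (α n) ≤ Real.log C + (Real.log n / 2 + Real.log (φ n)) := by
    refine (Real.log_le_log (T.α_pos n) hα).trans_eq ?_
    rw [Real.log_mul (by positivity) (by positivity), Real.log_mul (by positivity) hφ0.ne',
      Real.log_sqrt (by positivity)]
  -- The purpose of `64 a0²` in `Cβ`: it gives `8 a0 ≤ √φ`, and with `log φ ≤ 2 √φ` the term is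
  -- absorbed by `φ / 2`.
  have hlogφ : 2 * p.a0 * Real.log (φ n) ≤ φ n / 2 := by
    set q := Real.sqrt (φ n) with hq
    have hq0 : 0 ≤ q := Real.sqrt_nonneg _
    have hqq : q ^ 2 = φ n := Real.sq_sqrt hφ0.le
    have h2 : Real.log (φ n) ≤ 2 * q := by
      have h3 := Real.log_le_sub_one_of_pos (Real.sqrt_pos.2 hφ0)
      rw [Real.log_sqrt hφ0.le] at h3
      linarith
    have h4 : 8 * p.a0 ≤ q := by
      refine (pow_le_pow_iff_left₀ (by positivity) hq0 two_ne_zero).1 ?_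
      rw [hqq]
      linarith [V.a0_sq_le_Cβ]
    have h5 := mul_le_mul_of_nonneg_left h2 (by positivity : 0 ≤ 2 * p.a0)
    nlinarith
  have h2 := T.φ_le V n
  have h3 := mul_le_mul_of_nonneg_left
    ((T.ratioSum_le_log V n).trans (mul_le_mul_of_nonneg_left hlogα zero_le_two)) ha0
  have h4 := mul_nonneg ha0 hlog
  rw [Params.a1, Params.b1]
  linarith

/-- With `φ` logarithmic, `α ≤ X n`, since `√n` and `log n` are at most `n`. The value `2 log (X n)`
leaves slack in the coefficient `5` and in the `+ 1` of `c2`. -/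
theorem ratioSum_le (V : p.Valid) {n : ℕ} (hn : 1 ≤ n) :
    ratioSum h α n ≤ 5 * Real.log n + p.c2 := by
  have hn' : (1 : ℝ) ≤ n := by exact_mod_cast hn
  have hlog : 0 ≤ Real.log n := Real.log_nonneg hn'
  have hxa := mul_nonneg V.Cgxy_nonneg (Params.abar_nonneg V)
  have hxb := mul_nonneg V.Cgxy_nonneg (Params.bbar_nonneg V)
  have ha1 := Params.a1_nonneg V
  have hb1 := Params.b1_nonneg V
  set X := p.Cgxy * p.abar * p.a1 + p.Cgxy * p.abar * p.b1 + p.Cgxy * p.bbar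
    + p.Cfx + p.α0 with hX
  have hX0 : 0 < X := by
    have := V.α0_pos
    have := V.Cfx_nonneg
    positivity
  have hα : α n ≤ X * n := by
    have h1 := T.α_le V n
    have h2 := mul_le_mul_of_nonneg_left (T.φ_le_log V hn) hxa
    have h3 : Real.sqrt n ≤ n := by
      rw [Real.sqrt_le_left (by positivity)]; nlinarith
    have h4 := mul_le_mul_of_nonneg_left h3 (add_nonneg V.Cfx_nonneg hxb)
    have h5 := mul_le_mul_of_nonneg_left (Real.log_le_self (by positivity : (0 : ℝ) ≤ n))
      (mul_nonneg hxa ha1)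
    have h6 := mul_le_mul_of_nonneg_left hn' (mul_nonneg hxa hb1)
    have h7 := mul_le_mul_of_nonneg_left hn' V.α0_pos.le
    rw [hX]
    linarith
  have h1 := Real.log_le_log (T.α_pos n) hα
  rw [Real.log_mul hX0.ne' (by positivity)] at h1
  rw [Params.c2, ← hX]
  linarith [T.ratioSum_le_log V n]

theorem sum_G_le_log (V : p.Valid) {n : ℕ} (hn : 1 ≤ n) :
    ∑ k ∈ range n, G k ^ 2 / β (k + 1) ≤ p.a2 * Real.log n + p.b2 :=
  ((T.sum_G_le V n).trans (Params.b2Of_mono V (T.ratioSum_le V hn))).trans_eq (Params.b2Of_eq _)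

theorem sum_r_le_log (V : p.Valid) {n : ℕ} (hn : 1 ≤ n) :
    ∑ k ∈ range n, r k ^ 2 / φ (k + 1) ≤ p.a3 * Real.log n + p.b3 :=
  ((T.sum_r_le V n).trans (Params.b3Of_mono V (T.ratioSum_le V hn))).trans_eq (Params.b3Of_eq _)

/-! ### Growth of `α` through the descent of `Φ`. -/

/-- The error of the hypergradient estimate in terms of the two residuals. -/
theorem e_sq_add_u_sq_le (V : p.Valid) (k : ℕ) :
    e k ^ 2 + u k ^ 2
      ≤ (1 + 2 / p.μ ^ 2 * p.M ^ 2) / p.μ ^ 2 * G k ^ 2 + 2 / p.μ ^ 2 * r k ^ 2 := by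
  have hμ := V.μ_pos
  have h1 := pow_le_pow_left₀ (mul_nonneg hμ.le (T.e_nonneg k)) (T.e_le k) 2
  have h2 := pow_le_pow_left₀ (mul_nonneg hμ.le (T.u_nonneg k)) (T.u_le k) 2
  have h3 := T.M_mul_e_le V k
  have h4 : u k ^ 2 ≤ (2 * r k ^ 2 + 2 * (p.M ^ 2 * (1 / p.μ ^ 2) * G k ^ 2)) / p.μ ^ 2 := by
    rw [le_div_iff₀ (by positivity)]
    nlinarith [sq_nonneg (r k - p.M * e k)]
  have h5 : e k ^ 2 ≤ G k ^ 2 / p.μ ^ 2 := by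
    rw [le_div_iff₀ (by positivity)]
    linarith
  refine (add_le_add h5 h4).trans_eq ?_
  ring

/-- A sum weighted by `1 / α`, split where `α` passes `Cα`. -/
theorem sum_div_α_le (V : p.Valid) {a : ℕ → ℝ} (ha : ∀ k, 0 ≤ a k) {m n : ℕ} (hmn : m ≤ n)
    (hk : ∀ k, m ≤ k → k < n → p.Cα < α (k + 1)) {A B : ℝ} (hA : ∑ k ∈ range m, a k ≤ A)
    (hB : ∑ k ∈ range n, a k ≤ B) :
    ∑ k ∈ range n, a k / α (k + 1) ≤ B / p.Cα + A / p.α0 := by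
  have hα0 := V.α0_pos
  have hCα := V.Cα_pos
  rw [← sum_range_add_sum_Ico _ hmn, add_comm]
  refine add_le_add ?_ ?_
  · calc ∑ k ∈ Ico m n, a k / α (k + 1) ≤ ∑ k ∈ Ico m n, a k / p.Cα := by
          refine sum_le_sum fun k hkk => ?_
          have := ha k
          have := (hk k (mem_Ico.1 hkk).1 (mem_Ico.1 hkk).2).le
          gcongr
      _ ≤ _ := by
          rw [← sum_div]
          have := (sum_Ico_le_sum_range ha m n).trans hB
          gcongr
  · calc ∑ k ∈ range m, a k / α (k + 1) ≤ ∑ k ∈ range m, a k / p.α0 := by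
          refine sum_le_sum fun k _ => ?_
          have := ha k
          have := T.α0_le (k + 1)
          gcongr
      _ ≤ _ := by
          rw [← sum_div]
          gcongr

theorem α_zero_le : α 0 ≤ p.Cα := T.α_zero.trans_le Params.Valid.α0_le_Cα

/-- The summed hypergradient errors. -/
theorem sum_error_le (V : p.Valid) {m n : ℕ} (hn : 1 ≤ n) (hmn : m ≤ n) (hm : α m ≤ p.Cα)
    (hk : ∀ k, m ≤ k → k < n → p.Cα < α (k + 1)) :
    2 * ∑ k ∈ range n, p.Lbar ^ 2 * (e k ^ 2 + u k ^ 2) / (α (k + 1) * φ (k + 1))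
      ≤ p.a4 * Real.log n + p.b4 - 2 * p.LΦ / p.φ0 ^ 2 * (p.Cα ^ 2 / p.α0 ^ 2) := by
  have hμ := V.μ_pos
  have hα0 := V.α0_pos
  have hCα := V.Cα_pos
  have hαm := T.α_pos m
  -- For the rounds up to `m`, `α m ≤ Cα` bounds the drift by the constant `c₁`, with no logarithm
  -- of the round.
  have hS : ratioSum h α m ≤ 2 * Real.log (p.Cα / p.α0) := by
    refine (T.ratioSum_le_log_div m).trans ?_
    gcongr
  have h1 := T.sum_div_α_le V (a := fun k => G k ^ 2 / β (k + 1))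
    (fun k => div_nonneg (sq_nonneg _) (T.β_pos _).le) hmn hk
    ((T.sum_G_le V m).trans (Params.b2Of_mono V hS)) (T.sum_G_le_log V hn)
  have h2 := T.sum_div_α_le V (a := fun k => r k ^ 2 / φ (k + 1))
    (fun k => div_nonneg (sq_nonneg _) (T.φ_pos _).le) hmn hk
    ((T.sum_r_le V m).trans (Params.b3Of_mono V hS)) (T.sum_r_le_log V hn)
  have h3 : ∑ k ∈ range n, p.Lbar ^ 2 * (e k ^ 2 + u k ^ 2) / (α (k + 1) * φ (k + 1))
      ≤ ∑ k ∈ range n, (p.Lbar ^ 2 * ((1 + 2 / p.μ ^ 2 * p.M ^ 2) / p.μ ^ 2)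
          * (G k ^ 2 / β (k + 1) / α (k + 1))
        + p.Lbar ^ 2 * (2 / p.μ ^ 2) * (r k ^ 2 / φ (k + 1) / α (k + 1))) := by
    refine sum_le_sum fun k _ => ?_
    have hα := T.α_pos (k + 1)
    have hβ := T.β_pos (k + 1)
    have hφ := T.φ_pos (k + 1)
    calc p.Lbar ^ 2 * (e k ^ 2 + u k ^ 2) / (α (k + 1) * φ (k + 1))
        ≤ p.Lbar ^ 2 * ((1 + 2 / p.μ ^ 2 * p.M ^ 2) / p.μ ^ 2 * G k ^ 2 + 2 / p.μ ^ 2 * r k ^ 2)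
          / (α (k + 1) * φ (k + 1)) := by
          have := T.e_sq_add_u_sq_le V k
          gcongr
      _ = p.Lbar ^ 2 * ((1 + 2 / p.μ ^ 2 * p.M ^ 2) / p.μ ^ 2)
          * (G k ^ 2 / φ (k + 1) / α (k + 1))
        + p.Lbar ^ 2 * (2 / p.μ ^ 2) * (r k ^ 2 / φ (k + 1) / α (k + 1)) := by
          field_simp
      _ ≤ _ := by
          have := T.β_le_φ (k + 1)
          gcongr
  rw [sum_add_distrib, ← mul_sum, ← mul_sum] at h3
  have h4 := mul_le_mul_of_nonneg_left h1
    (by positivity : 0 ≤ p.Lbar ^ 2 * ((1 + 2 / p.μ ^ 2 * p.M ^ 2) / p.μ ^ 2))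
  have h5 := mul_le_mul_of_nonneg_left h2 (by positivity : 0 ≤ p.Lbar ^ 2 * (2 / p.μ ^ 2))
  refine (mul_le_mul_of_nonneg_left (h3.trans (add_le_add h4 h5)) zero_le_two).trans_eq ?_
  rw [Params.a4, Params.b4]
  field_simp
  ring

/-- After `m`, `α` grows by at most `h²/α = (h²/(αφ)) φ ≤ (h²/(αφ)) φ_n` per round, so it suffices
to bound the sum of `h²/(αφ)` by the decrease of `Φ` and the hypergradient errors. -/
theorem α_le_log (V : p.Valid) {n : ℕ} (hn : 1 ≤ n) {c : ℝ} (hc : c ≤ F n) :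
    α n ≤ p.Cα + (p.a4 * Real.log n + p.b4 + 4 * (F 0 - c)) * φ n := by
  have hα0 := V.α0_pos
  have hφ0 := V.φ0_pos
  have hLΦ := V.LΦ_nonneg
  obtain ⟨m, hmn, hm, hk⟩ := exists_last_le T.α_zero_le n
  set W : ℕ → ℝ := fun k => p.Lbar ^ 2 * (e k ^ 2 + u k ^ 2) / (α (k + 1) * φ (k + 1)) with hW
  have hstep := T.F_step
  have hX0 : ∀ k, 0 ≤ h k ^ 2 / (α (k + 1) * φ (k + 1)) := fun k =>
    div_nonneg (sq_nonneg _) (mul_pos (T.α_pos _) (T.φ_pos _)).le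
  have hsq : ∀ k, (h k / (α (k + 1) * φ (k + 1))) ^ 2
      = h k ^ 2 / (α (k + 1) * φ (k + 1)) / (α (k + 1) * φ (k + 1)) := fun k => by
    rw [div_pow, div_div, sq (α (k + 1) * φ (k + 1))]
  -- Below `Cα` the curvature term need not be dominated by the decrease, so the decrease is
  -- discarded and `Σ h² ≤ Cα²` bounds the curvature. This is the last summand of `b4`.
  have hbefore : 4 * F m ≤ 4 * F 0 + 2 * ∑ k ∈ range m, W k
      + 2 * p.LΦ / p.φ0 ^ 2 * (p.Cα ^ 2 / p.α0 ^ 2) := by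
    have hind : ∀ j, 4 * F j ≤ 4 * F 0 + 2 * ∑ k ∈ range j, W k
        + 2 * p.LΦ / p.φ0 ^ 2 * ((∑ k ∈ range j, h k ^ 2) / p.α0 ^ 2) := by
      intro j
      induction j with
      | zero => simp
      | succ j ih =>
        rw [sum_range_succ, sum_range_succ]
        have h1 : p.LΦ * (h j / (α (j + 1) * φ (j + 1))) ^ 2
            ≤ p.LΦ / p.φ0 ^ 2 * (h j ^ 2 / p.α0 ^ 2) := by
          calc p.LΦ * (h j / (α (j + 1) * φ (j + 1))) ^ 2
              ≤ p.LΦ * (h j / (p.α0 * p.φ0)) ^ 2 := by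
                have := T.h_nonneg j
                have := T.α0_le (j + 1)
                have := T.φ0_le (j + 1)
                have := T.α_pos (j + 1)
                have := T.φ_pos (j + 1)
                gcongr
            _ = _ := by field_simp
        have h2 := hstep j
        have h3 := hX0 j
        have h4 : 2 * p.LΦ / p.φ0 ^ 2 * ((∑ k ∈ range j, h k ^ 2 + h j ^ 2) / p.α0 ^ 2)
            = 2 * p.LΦ / p.φ0 ^ 2 * ((∑ k ∈ range j, h k ^ 2) / p.α0 ^ 2)
              + 2 * (p.LΦ / p.φ0 ^ 2 * (h j ^ 2 / p.α0 ^ 2)) := by ring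
        rw [h4]
        simp only [hW] at ih ⊢
        linarith
    refine (hind m).trans ?_
    have h1 : ∑ k ∈ range m, h k ^ 2 ≤ p.Cα ^ 2 := by
      have h2 := T.accα.sq_eq m
      have h3 := pow_le_pow_left₀ (T.α_pos m).le hm 2
      linarith [sq_nonneg (α 0)]
    gcongr
  have hafter : ∀ j, m ≤ j → j ≤ n → ∑ k ∈ Ico m j, h k ^ 2 / (α (k + 1) * φ (k + 1))
      ≤ 4 * (F m - F j) + 2 * ∑ k ∈ Ico m j, W k := by
    intro j hmj
    induction j, hmj using Nat.le_induction with
    | base => simp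
    | succ j hmj ih =>
      intro hj
      have ih := ih (by omega)
      rw [sum_Ico_succ_top hmj, sum_Ico_succ_top hmj]
      have hαφ : p.Cα * p.φ0 ≤ α (j + 1) * φ (j + 1) := by
        have h1 := (hk j hmj (by omega)).le
        have h2 := T.φ0_le (j + 1)
        have h3 := (T.α_pos (j + 1)).le
        gcongr
      -- Here `αφ ≥ Cα φ0 ≥ 2 LΦ`, so curvature uses up half of the decrease `h²/(αφ)/2`; the
      -- quarter left over explains the factor `4` before `F m - F j`.
      have h1 : p.LΦ * (h j / (α (j + 1) * φ (j + 1))) ^ 2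
          ≤ h j ^ 2 / (α (j + 1) * φ (j + 1)) / 2 := by
        have h2 : 0 < α (j + 1) * φ (j + 1) := mul_pos (T.α_pos _) (T.φ_pos _)
        rw [hsq, mul_div_assoc', div_le_iff₀ h2]
        have h3 : 2 * p.LΦ ≤ α (j + 1) * φ (j + 1) := V.two_mul_LΦ_le.trans hαφ
        nlinarith [mul_le_mul_of_nonneg_right h3 (hX0 j)]
      have h2 := hstep j
      simp only [hW] at ih ⊢
      linarith
  have hsum := T.sum_error_le V hn hmn hm hk
  have h1 := hafter n hmn le_rfl
  have h2 : α n ≤ p.Cα + (∑ k ∈ Ico m n, h k ^ 2 / (α (k + 1) * φ (k + 1))) * φ n := by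
    refine (T.accα.le_add_sum hmn).trans (add_le_add hm ?_)
    rw [sum_mul]
    refine sum_le_sum fun k hkk => ?_
    have h3 := T.φ_pos (k + 1)
    have h4 := T.α_pos (k + 1)
    have h5 : h k ^ 2 / α (k + 1) = h k ^ 2 / (α (k + 1) * φ (k + 1)) * φ (k + 1) := by
      field_simp
    rw [h5]
    exact mul_le_mul_of_nonneg_left (T.φ_mono (mem_Ico.1 hkk).2) (hX0 k)
  refine h2.trans (add_le_add le_rfl (mul_le_mul_of_nonneg_right ?_ (T.φ_pos n).le))
  have h3 := sum_range_add_sum_Ico W hmn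
  simp only [hW] at h3 h1 hbefore
  linarith

end Trajectory

end STFBO

theorem mainTheorem6 {dx dy : ℕ} (hdy : 0 < dy)
    (f g : STFBO.Vec dx → STFBO.Vec dy → ℝ) (p : STFBO.Params)
    (hμ : 0 < p.μ) (hsmooth : STFBO.Smooth f g p) (hlip : STFBO.Lip f g p)
    (hα0 : 1 ≤ p.α0) (hβ0 : 0 < p.β0) (hγ0 : 0 < p.γ0)
    (x₀ : STFBO.Vec dx) (y₀ v₀ : STFBO.Vec dy)
    (hG0 : p.G0 = ‖STFBO.gradY g x₀ y₀‖) (hR0 : p.R0 = ‖STFBO.gradR f g x₀ y₀ v₀‖)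
    (s : ℕ → STFBO.State dx dy)
    (hs : s = STFBO.run f g
      { x := x₀, y := y₀, v := v₀, α := p.α0, β := p.β0, γ := p.γ0 }) :
    (∀ k₀ t : ℕ, k₀ < t →
      ∑ k ∈ Finset.Icc k₀ t, ‖STFBO.gradY g (s k).x (s k).y‖ ^ 2 / (s (k + 1)).β
        ≤ p.a2 * Real.log ((t : ℝ) + 1) + p.b2 ∧
      ∑ k ∈ Finset.Icc k₀ t, ‖STFBO.gradR f g (s k).x (s k).y (s k).v‖ ^ 2 / (s (k + 1)).φ
        ≤ p.a3 * Real.log ((t : ℝ) + 1) + p.b3) ∧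
    (∀ t : ℕ, 1 ≤ t → (s t).φ ≤ p.a1 * Real.log (t : ℝ) + p.b1) ∧
    ((∃ m : ℝ, ∀ x, m ≤ STFBO.Phi f g x) →
      ∀ t : ℕ, 1 ≤ t →
        (s t).α ≤ p.Cα + (p.a4 * Real.log (t : ℝ) + p.b4
          + 4 * (STFBO.Phi f g x₀ - ⨅ x, STFBO.Phi f g x)) * (s t).φ) := by
  have V := hlip.valid hμ hsmooth hdy hα0 hβ0 hγ0
  have T := STFBO.trajectory_run hdy hμ hsmooth hlip hα0 hβ0 hγ0 x₀ y₀ v₀ hG0 hR0 s hs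
  -- The terms are nonnegative, so the sum may start at `0`; it includes `k = t`, so the bounds are
  -- used with `n = t + 1`, whence `log (t + 1)`.
  have hIcc : ∀ (a : ℕ → ℝ) (k₀ t : ℕ), (∀ k, 0 ≤ a k) →
      ∑ k ∈ Finset.Icc k₀ t, a k ≤ ∑ k ∈ Finset.range (t + 1), a k := fun a k₀ t ha =>
    Finset.sum_le_sum_of_subset_of_nonneg
      (fun k hk => Finset.mem_range.2 (Nat.lt_succ_of_le (Finset.mem_Icc.1 hk).2))
      fun k _ _ => ha k
  refine ⟨fun k₀ t _ => ⟨?_, ?_⟩, fun t ht => T.φ_le_log V ht, ?_⟩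
  · have h1 := T.sum_G_le_log V (n := t + 1) (by omega)
    push_cast at h1
    exact (hIcc _ k₀ t fun k => div_nonneg (sq_nonneg _) (T.β_pos _).le).trans h1
  · have h1 := T.sum_r_le_log V (n := t + 1) (by omega)
    push_cast at h1
    exact (hIcc _ k₀ t fun k => div_nonneg (sq_nonneg _) (T.φ_pos _).le).trans h1
  · rintro ⟨m, hm⟩ t ht
    have h1 := T.α_le_log V ht (c := ⨅ x, STFBO.Phi f g x)
      (ciInf_le ⟨m, Set.forall_mem_range.2 hm⟩ _)
    have h2 : (s 0).x = x₀ := by rw [hs]; rfl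
    simp only [h2] at h1
    exact h1
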